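/- **Model.** A list-labeling algorithm of capacity $n$ on an array of $m$ slots keeps a dynamic set of at most $n$ elements in sorted order in the array, starting from the empty set. An operation inserts or deletes the element of a given rank; the algorithm is online and sees only the ranks. Its random bits are independent of the input sequence (oblivious adversary). The cost of an operation is the number of element moves; placing the new element counts as a move, removing an element does not. The algorithm has *worst-case cost* $W$ if every operation costs at most $W$ for every input and all random bits. It has *amortized expected cost* $c$ on an input sequence if for every $t$ the first $t$ operations have expected total cost at most $tc$. It has *lightly-amortized expected cost* $c$, with hidden constant $A$, if on every input sequence any $T$ consecutive operations have expected total cost at most $A(Tc+n)$. **Theorem.** Let $0<\lambda\le\Lambda$ and $A>0$. There is a constant $C>0$, depending only on $\lambda,\Lambda,A$, and for all integers $n,e\ge 0$ and reals $E_R,W_R$ there is a black-box construction that turns a list-labeling algorithm of capacity $n$ on $n+e$ slots and one of capacity $n+2e$ on $n+3e$ slots into a list-labeling algorithm of capacity $n$ on $n+3e$ slots, such that the following holds whenever $\lambda n\le e\le\Lambda n$. Let $R$ be a randomized list-labeling algorithm of capacity $n+2e$ on $n+3e$ slots that has lightly-amortized expected cost $E_R$ (with hidden constant $A$) and worst-case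 cost $W_R$, and let $F$ be a randomized list-labeling algorithm of capacity $n$ on $n+e$ slots. Let $F\triangleleft R$ be the result of the construction applied to $F$ and $R$, run with independent random bits. Then $F\triangleleft R$ is a list-labeling algorithm of capacity $n$ on an array of $n+3e=(1+\Theta(1))n$ slots, and: 1. (Worst-case cost) $F\triangleleft R$ has worst-case cost at most $C\,W_R$. 2. (Good-case cost) If, for a function $G_F$ of the input sequence, $F$ has amortized expected cost $G_F(\bar x)$ on every input sequence $\bar x$, then on every input sequence $\bar x$ and for every $t\le|\bar x|$ the expected total cost of $F\triangleleft R$ on the first $t$ operations is at most $C\,(t\,G_F(\bar x)+n)$; moreover, for every $\delta>0$, if $t\ge\delta n$, it is at most $C(1+1/\delta)\,t\,G_F(\bar x)$. That is, the amortized expected cost is $O(G_F(\bar x))$ on inputs of length $\Omega(n)$. 3. (General cost) $F\triangleleft R$ has lightly-amortized expected cost $E_R$, with hidden constant $C$. 4. If $F$ has lightly-amortized expected cost $g$ (with hidden constant $A$) for a value $g$ that does not depend on the input, then $F\triangleleft R$ has lightly-amortized expected cost $g$, with hidden constant $C$. -/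

import Mathlib

namespace ListLabeling

/-- An operation. Ranks are counted from `0`: `insert r` adds a new element that has exactly `r`
smaller elements, `delete r` removes the element that has exactly `r` smaller elements. -/
inductive Op where
  | insert (r : ℕ)
  | delete (r : ℕ)

/-- The number of stored elements after an operation, if there are `k` before it. -/
def Op.newSize (k : ℕ) : Op → ℕ
  | .insert _ => k + 1
  | .delete _ => k - 1

/-- An operation is allowed when `k` elements are stored and the capacity is `n`. -/
def Op.Allowed (n k : ℕ) : Op → Prop
  | .insert r => r ≤ k ∧ k < n
  | .delete r => r < k

/-- The number of stored elements after a sequence of operations on an initially empty array. -/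
def size (x : List Op) : ℕ := x.foldl Op.newSize 0

/-- `x` is an input sequence for capacity `n`: every operation is allowed when it is performed. -/
def Legal (n : ℕ) (x : List Op) : Prop :=
  ∀ (t : ℕ) (ht : t < x.length), (x[t]).Allowed n (size (x.take t))

/-- The number of element moves in one operation. There are `k` elements before it, `p i` is the
slot of the `i`-th smallest element before and `q i` the one after the operation. An element that
is present before and after is moved if its slot changes. Writing the newly
inserted element into its slot counts as one move, removing an element counts as none. -/
def Op.moves (k : ℕ) (p q : ℕ → ℕ) : Op → ℕ
  | .insert r => 1 + ((Finset.range k).filter fun i => q (if i < r then i else i + 1) ≠ p i).card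
  | .delete r =>
      ((Finset.range (k - 1)).filter fun i => q i ≠ p (if i < r then i else i + 1)).card

/-- A deterministic (online) list-labeling algorithm of capacity `n` on an array of `m` slots.
After the operations `h`, the `i`-th smallest stored element (`i < size h`) sits in slot `pos h i`,
and the elements appear in sorted order in distinct slots. The algorithm sees only the ranks in
the operations so far. Other values of `pos` are irrelevant. -/
structure DetAlg (n m : ℕ) where
  pos : List Op → ℕ → ℕ
  pos_lt : ∀ h, Legal n h → ∀ i, i < size h → pos h i < m
  sorted : ∀ h, Legal n h → ∀ i j, i < j → j < size h → pos h i < pos h j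

/-- The cost of the `t`-th operation (counted from `0`) of `x`. -/
def DetAlg.cost {n m : ℕ} (D : DetAlg n m) (x : List Op) (t : ℕ) : ℕ :=
  match x[t]? with
  | some o => o.moves (size (x.take t)) (D.pos (x.take t)) (D.pos (x.take (t + 1)))
  | none => 0

/-- A randomized list-labeling algorithm of capacity `n` on an array of `m` slots: random bits
`ω`, drawn once and for all, select a deterministic algorithm. The input sequences are fixed
independently of `ω` (oblivious adversary). -/
structure Alg (n m : ℕ) where
  Ω : Type
  [measurableSpace : MeasurableSpace Ω]
  μ : MeasureTheory.Measure Ω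
  [isProbabilityMeasure : MeasureTheory.IsProbabilityMeasure μ]
  run : Ω → DetAlg n m
  measurable_pos : ∀ h i, Measurable fun ω => (run ω).pos h i

attribute [instance] Alg.measurableSpace Alg.isProbabilityMeasure

namespace Alg

variable {n m : ℕ}

/-- The expected total cost of the operations number `a, …, b - 1` of `x`. -/
noncomputable def expCost (L : Alg n m) (x : List Op) (a b : ℕ) : ℝ :=
  ∫ ω, ∑ t ∈ Finset.Ico a b, ((L.run ω).cost x t : ℝ) ∂L.μ

/-- Every operation costs at most `W`, whatever the input and the random bits. -/
def WorstCase (L : Alg n m) (W : ℝ) : Prop :=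
  ∀ x, Legal n x → ∀ t < x.length, ∀ ω, ((L.run ω).cost x t : ℝ) ≤ W

/-- On the input sequence `x`, the expected average cost per operation is at most `c` on every
prefix that has at least `s` operations (on every prefix if `s = 0`). -/
def AmortizedFrom (L : Alg n m) (s : ℝ) (x : List Op) (c : ℝ) : Prop :=
  ∀ t ≤ x.length, s ≤ t → L.expCost x 0 t ≤ t * c

/-- Lightly-amortized expected cost `c` per operation on every input sequence, with hidden
constant `A`: any `T` consecutive operations have expected total cost at most `A (T c + n)`. -/
def LightlyAmortized (L : Alg n m) (A c : ℝ) : Prop :=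
  ∀ x, Legal n x → ∀ a b, a ≤ b → b ≤ x.length →
    L.expCost x a b ≤ A * (((b : ℝ) - a) * c + n)

/-- The randomized algorithm that applies a black-box combination `f` of deterministic algorithms
to `F` and `R`, run with independent random bits. -/
noncomputable def combine {n₁ m₁ n₂ m₂ : ℕ} (f : DetAlg n₁ m₁ → DetAlg n₂ m₂ → DetAlg n m)
    (F : Alg n₁ m₁) (R : Alg n₂ m₂)
    (hf : ∀ h i, Measurable fun ω : F.Ω × R.Ω => (f (F.run ω.1) (R.run ω.2)).pos h i) :
    Alg n m where
  Ω := F.Ω × R.Ω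
  μ := F.μ.prod R.μ
  run := fun ω => f (F.run ω.1) (R.run ω.2)
  measurable_pos := hf

end Alg

end ListLabeling

open ListLabeling

/-! The reliable algorithm `R` serves as the physical array. It stores rational keys, and a stored
element that carries a key sits in the slot where `R` keeps that key. The keys `0, …, n + e - 1`
stand for the slots of the fast algorithm `F` and are never removed from `R`. Thus every layout of
`F` can be realized by giving elements these keys, without any operation of `R`.

Each element has a current key and a target key. With `b` the rate of rebuilding, an operation is
treated in one of two ways. If at most `b + 1` label changes lead to the present layout of `F`, they
are made at once. Otherwise a new element receives fresh current and target keys, which takes at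
most four operations of `R`, and `b + 1` elements are moved to their targets. Once all targets are
reached, the present layout of `F` becomes the target. A rebuilding that is not finished is shorter
than `e / 8` operations, because `8 * n ≤ b * e`; so the keys in use fit into the capacity `n + 2 *
e`, and unused keys can be evicted (`State.Valid.exists_slow_step`).

Let `c` be the number of moves apart from those made by `R`. Three estimates carry the theorem.
First, `c ≤ b + 2` per operation, and `R` performs at most four operations; this gives the
worst-case and the general bound. Second, the potential, twice the distance to the target plus three
times the distance from the target to `F`, shows that `c` totals at most `5 * n` plus six times the
cost of `F`. Third, `R` is called only in operations with `c ≥ b + 1`; as `b ≥ min E W`, its cost is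
`O(c)` up to a term `O(n + e)`, so it too is paid for by `F`.

The operations given to `R` depend only on the input and on the random bits of `F`. For fixed bits
of `F` they are therefore an oblivious input for `R`, and Fubini gives the expectations
(`Alg.expCost_combine_le`). -/

namespace ListLabeling

open Finset

/-! ### Label changes and Hamming distance -/

section Hamming

variable {α β : Type*} [DecidableEq α] [DecidableEq β]

/-- The increasing enumeration of the natural numbers different from `r`. -/
def skip (r i : ℕ) : ℕ := if i < r then i else i + 1

/-- The number of indices below `k` at which two sequences differ. -/
def hamming (k : ℕ) (p q : ℕ → α) : ℕ := #{i ∈ range k | p i ≠ q i}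

lemma skip_strictMono (r : ℕ) : StrictMono (skip r) := by
  intro i j h
  unfold skip; split_ifs <;> omega

lemma skip_lt {r i k : ℕ} (h : i < k) : skip r i < k + 1 := by
  unfold skip; split_ifs <;> omega

lemma exists_skip_eq {r i : ℕ} (h : i ≠ r) : ∃ j, skip r j = i := by
  rcases lt_or_gt_of_ne h with h | h
  · exact ⟨i, by simp [skip, h]⟩
  · exact ⟨i - 1, by unfold skip; split_ifs <;> omega⟩

lemma hamming_le (k : ℕ) (p q : ℕ → α) : hamming k p q ≤ k := by
  simpa [hamming] using card_filter_le (range k) fun i => p i ≠ q i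

@[simp] lemma hamming_self (k : ℕ) (p : ℕ → α) : hamming k p p = 0 := by simp [hamming]

lemma hamming_triangle (k : ℕ) (p q s : ℕ → α) :
    hamming k p s ≤ hamming k p q + hamming k q s := by
  unfold hamming
  refine (card_le_card ?_).trans (card_union_le _ _)
  intro i
  simp only [mem_filter, mem_union]
  grind

lemma hamming_congr {k : ℕ} {p p' q q' : ℕ → α} (hp : ∀ i < k, p i = p' i)
    (hq : ∀ i < k, q i = q' i) : hamming k p q = hamming k p' q' := by
  unfold hamming
  congr 1
  apply filter_congr
  intro i hi
  rw [hp i (mem_range.1 hi), hq i (mem_range.1 hi)]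

lemma hamming_comp_le (k : ℕ) (f : α → β) (p q : ℕ → α) :
    hamming k (fun i => f (p i)) (fun i => f (q i)) ≤ hamming k p q := by
  refine card_le_card fun i => ?_
  simp only [mem_filter]
  grind

lemma eq_of_hamming_eq_zero {k : ℕ} {p q : ℕ → α} (h : hamming k p q = 0) (i : ℕ) (hi : i < k) :
    p i = q i := by
  by_contra hne
  rw [hamming, card_eq_zero] at h
  have : i ∈ ({i ∈ range k | p i ≠ q i} : Finset ℕ) := by simp [hi, hne]
  simp [h] at this

lemma hamming_skip_le (k r : ℕ) (p q : ℕ → α) :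
    hamming k (fun i => p (skip r i)) (fun i => q (skip r i)) ≤ hamming (k + 1) p q := by
  unfold hamming
  refine card_le_card_of_injOn (skip r) ?_ (skip_strictMono r).injective.injOn
  intro i
  simp only [coe_filter, mem_range, Set.mem_ofPred_eq]
  exact fun h => ⟨skip_lt h.1, h.2⟩

lemma hamming_succ_le {k r : ℕ} (hr : r ≤ k) (p q : ℕ → α) :
    hamming (k + 1) p q ≤ 1 + hamming k (fun i => p (skip r i)) (fun i => q (skip r i)) := by
  unfold hamming
  rw [add_comm 1, ← card_image_of_injective {i ∈ range k | p (skip r i) ≠ q (skip r i)}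
    (skip_strictMono r).injective]
  refine (card_le_card ?_).trans (card_insert_le r _)
  intro i
  simp only [mem_filter, mem_range, mem_insert, mem_image]
  rintro ⟨hi, hne⟩
  by_cases h : i = r
  · exact Or.inl h
  · obtain ⟨j, rfl⟩ := exists_skip_eq h
    refine Or.inr ⟨j, ⟨?_, hne⟩, rfl⟩
    unfold skip at hi
    split_ifs at hi <;> omega

lemma hamming_update (k : ℕ) (w v : ℕ → α) {i : ℕ} (hi : i < k) (hne : w i ≠ v i) :
    hamming k (Function.update w i (v i)) v + 1 ≤ hamming k w v := by
  unfold hamming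
  rw [← card_erase_add_one (s := ({j ∈ range k | w j ≠ v j} : Finset ℕ)) (a := i)
    (by simp [hi, hne])]
  gcongr
  intro j
  simp only [mem_filter, mem_erase, Function.update_apply]
  grind

lemma hamming_update_self_le (k : ℕ) (w : ℕ → α) (i : ℕ) (a : α) :
    hamming k w (Function.update w i a) ≤ 1 := by
  unfold hamming
  refine (card_le_card (t := {i}) ?_).trans (by simp)
  intro j
  simp only [mem_filter, mem_singleton, Function.update_apply]
  grind

/-- The number of elements whose label changes in an operation, `Op.moves` for labels in an
arbitrary type. -/
def Op.changes (k : ℕ) (p q : ℕ → α) : Op → ℕ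
  | .insert r => 1 + hamming k p fun i => q (skip r i)
  | .delete r => hamming (k - 1) (fun i => p (skip r i)) q

/-- The number of new elements of an operation. -/
def Op.weight : Op → ℕ
  | .insert _ => 1
  | .delete _ => 0

/-- The labels after an operation if `x` is the label of a new element and no label changes. -/
def Op.relabel (x : α) (f : ℕ → α) : Op → ℕ → α
  | .insert r => fun i => if i < r then f i else if i = r then x else f (i - 1)
  | .delete r => fun i => f (skip r i)

lemma Op.moves_eq_changes (o : Op) (k : ℕ) (p q : ℕ → ℕ) : o.moves k p q = o.changes k p q := by
  cases o with
  | insert r =>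
    refine congrArg (1 + card ·) (filter_congr fun i _ => ?_)
    exact ne_comm
  | delete r =>
    refine congrArg card (filter_congr fun i _ => ?_)
    exact ne_comm

lemma Op.weight_le_changes (o : Op) (k : ℕ) (p q : ℕ → α) : o.weight ≤ o.changes k p q := by
  cases o <;> simp [Op.weight, Op.changes]

lemma Op.weight_le_one (o : Op) : o.weight ≤ 1 := by
  cases o <;> simp [Op.weight]

lemma Op.changes_le_newSize (o : Op) (k : ℕ) (p q : ℕ → α) : o.changes k p q ≤ o.newSize k := by
  cases o with
  | insert r =>
    have := hamming_le k p fun i => q (skip r i)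
    simp only [Op.changes, Op.newSize]; omega
  | delete r => exact hamming_le _ _ _

lemma Op.changes_comp_le (o : Op) (k : ℕ) (f : α → β) (p q : ℕ → α) :
    o.changes k (fun i => f (p i)) (fun i => f (q i)) ≤ o.changes k p q := by
  cases o with
  | insert r => exact Nat.add_le_add_left (hamming_comp_le k f p _) _
  | delete r => exact hamming_comp_le (k - 1) f _ q

lemma Op.changes_congr {o : Op} {n k : ℕ} (ho : o.Allowed n k) {p p' q q' : ℕ → α}
    (hp : ∀ i < k, p i = p' i) (hq : ∀ i < o.newSize k, q i = q' i) :
    o.changes k p q = o.changes k p' q' := by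
  cases o with
  | insert r =>
    exact congrArg (1 + ·) (hamming_congr hp fun i hi => hq _ (skip_lt hi))
  | delete r =>
    refine hamming_congr (fun i hi => hp _ ?_) hq
    have := skip_lt (r := r) hi
    omega

lemma Op.changes_le_hamming_add {o : Op} {n k : ℕ} (ho : o.Allowed n k) (p p' q : ℕ → α) :
    o.changes k p q ≤ hamming k p p' + o.changes k p' q := by
  cases o with
  | insert r =>
    have := hamming_triangle k p p' fun i => q (skip r i)
    simp only [Op.changes]; omega
  | delete r =>
    have h1 := hamming_triangle (k - 1) (fun i => p (skip r i)) (fun i => p' (skip r i)) q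
    have h2 := hamming_skip_le (k - 1) r p p'
    have h3 : r < k := ho
    rw [show k - 1 + 1 = k by omega] at h2
    simp only [Op.changes]; omega

lemma Op.changes_le_add_hamming (o : Op) (k : ℕ) (p q q' : ℕ → α) :
    o.changes k p q' ≤ o.changes k p q + hamming (o.newSize k) q q' := by
  cases o with
  | insert r =>
    have h1 := hamming_triangle k p (fun i => q (skip r i)) fun i => q' (skip r i)
    have h2 := hamming_skip_le k r q q'
    simp only [Op.changes, Op.newSize]; omega
  | delete r => exact hamming_triangle _ _ _ _

lemma Op.relabel_insert_skip (r : ℕ) (x : α) (f : ℕ → α) :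
    (fun i => (Op.insert r).relabel x f (skip r i)) = f := by
  funext i
  simp only [Op.relabel, skip]
  split_ifs <;> first | rfl | omega

lemma Op.changes_relabel (o : Op) (k : ℕ) (x : α) (f : ℕ → α) :
    o.changes k f (o.relabel x f) = o.weight := by
  cases o with
  | insert r => simp [Op.changes, Op.relabel_insert_skip, Op.weight]
  | delete r => simp [Op.changes, Op.relabel, Op.weight]

/-- The new element adds at most one difference, and `Op.changes` charges one for an insertion
anyway. -/
lemma Op.hamming_relabel_le {o : Op} {n k : ℕ} (ho : o.Allowed n k) (x : α) (f q : ℕ → α) :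
    hamming (o.newSize k) (o.relabel x f) q ≤ o.changes k f q := by
  cases o with
  | insert r =>
    have := hamming_succ_le ho.1 ((Op.insert r).relabel x f) q
    rwa [Op.relabel_insert_skip] at this
  | delete r => exact le_rfl

end Hamming

/-! ### Finite key sets and ranks -/

section Rank

/-- The number of keys in `S` below `x`. -/
def rank (S : Finset ℚ) (x : ℚ) : ℕ := #{y ∈ S | y < x}

lemma rank_lt_card {S : Finset ℚ} {x : ℚ} (hx : x ∈ S) : rank S x < #S :=
  card_lt_card (filter_ssubset.2 ⟨x, hx, lt_irrefl x⟩)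

lemma rank_le_card (S : Finset ℚ) (x : ℚ) : rank S x ≤ #S := card_filter_le _ _

lemma rank_lt_rank {S : Finset ℚ} {x y : ℚ} (hx : x ∈ S) (h : x < y) : rank S x < rank S y := by
  refine card_lt_card ((ssubset_iff_of_subset ?_).2 ⟨x, by simp [hx, h], by simp⟩)
  exact monotone_filter_right S fun z _ hz => lt_trans hz h

lemma rank_injOn (S : Finset ℚ) : Set.InjOn (rank S) S := by
  intro x hx y hy h
  rcases lt_trichotomy x y with hlt | heq | hlt
  · exact absurd h (rank_lt_rank hx hlt).ne
  · exact heq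
  · exact absurd h (rank_lt_rank hy hlt).ne'

lemma rank_insert_self (S : Finset ℚ) (x : ℚ) : rank (insert x S) x = rank S x := by
  simp [rank, filter_insert]

lemma rank_insert {S : Finset ℚ} {x y : ℚ} (hx : x ∉ S) (hy : y ∈ S) :
    rank (insert x S) y = skip (rank S x) (rank S y) := by
  have hne : x ≠ y := fun h => hx (h ▸ hy)
  rcases lt_or_gt_of_ne hne with h | h
  · have h1 : rank S x ≤ rank S y :=
      card_le_card (monotone_filter_right S fun z _ hz => lt_trans hz h)
    have h2 : rank (insert x S) y = rank S y + 1 := by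
      unfold rank
      rw [filter_insert, if_pos h, card_insert_of_notMem (by simp [hx])]
    rw [h2, skip, if_neg h1.not_gt]
  · have h1 := rank_lt_rank hy h
    have h2 : rank (insert x S) y = rank S y := by
      unfold rank
      rw [filter_insert, if_neg h.not_gt]
    rw [h2, skip, if_pos h1]

/-- Rank is injective on keys, so keys that change slot inject into the elements moved by the
operation on ranks. -/
lemma card_moved_insert_le {S : Finset ℚ} {x : ℚ} (hx : x ∉ S) (p q : ℕ → ℕ) :
    #{y ∈ S | p (rank S y) ≠ q (rank (insert x S) y)} ≤
      (Op.insert (rank S x)).changes #S p q := by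
  refine le_trans ?_ (Nat.le_add_left _ 1)
  refine card_le_card_of_injOn (rank S) ?_
    ((rank_injOn S).mono fun y hy => (mem_filter.1 (mem_coe.1 hy)).1)
  intro y
  simp only [coe_filter, mem_range, Set.mem_ofPred_eq]
  exact fun h => ⟨rank_lt_card h.1, by simpa [rank_insert hx h.1] using h.2⟩

lemma card_moved_erase_le {S : Finset ℚ} {x : ℚ} (hx : x ∈ S) (p q : ℕ → ℕ) :
    #{y ∈ S.erase x | p (rank S y) ≠ q (rank (S.erase x) y)} ≤
      (Op.delete (rank S x)).changes #S p q := by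
  simp only [Op.changes, hamming]
  refine card_le_card_of_injOn (rank (S.erase x)) ?_
    ((rank_injOn _).mono fun y hy => (mem_filter.1 (mem_coe.1 hy)).1)
  intro y
  simp only [coe_filter, mem_range, Set.mem_ofPred_eq, ← card_erase_of_mem hx]
  refine fun h => ⟨rank_lt_card h.1, ?_⟩
  have h1 := rank_insert (notMem_erase x S) h.1
  rw [← rank_insert_self (S.erase x), insert_erase hx] at h1
  rw [← h1]
  exact h.2

end Rank

/-! ### Operation sequences and their costs -/

section History

variable {n m : ℕ}

@[simp] lemma size_append_singleton (h : List Op) (o : Op) :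
    size (h ++ [o]) = o.newSize (size h) := by
  simp [size]

lemma legal_append_singleton {h : List Op} {o : Op} :
    Legal n (h ++ [o]) ↔ Legal n h ∧ o.Allowed n (size h) := by
  constructor
  · intro H
    refine ⟨fun t ht => ?_, ?_⟩
    · have := H t (by simp; omega)
      rwa [List.getElem_append_left ht, List.take_append_of_le_length ht.le] at this
    · simpa using H h.length (by simp)
  · rintro ⟨H, ho⟩ t ht
    rcases Nat.lt_or_ge t h.length with h1 | h1
    · rw [List.getElem_append_left h1, List.take_append_of_le_length h1.le]
      exact H t h1
    · obtain rfl : t = h.length := by simp at ht; omega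
      simpa using ho

lemma legal_nil : Legal n [] := fun _ ht => absurd ht (by simp)

lemma Legal.take {x : List Op} (hx : Legal n x) (t : ℕ) : Legal n (x.take t) := by
  intro s hs
  have h1 : s < t := by simp at hs; omega
  have h2 : s < x.length := by simp at hs; omega
  rw [List.getElem_take, List.take_take, min_eq_left h1.le]
  exact hx s h2

lemma Legal.size_le {h : List Op} (H : Legal n h) : size h ≤ n := by
  induction h using List.reverseRecOn with
  | nil => simp [size]
  | append_singleton h o ih =>
    obtain ⟨H, ho⟩ := legal_append_singleton.1 H
    have := ih H
    rw [size_append_singleton]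
    cases o with
    | insert r => exact ho.2
    | delete r => simp only [Op.newSize]; omega

lemma legal_zero {x : List Op} (hx : Legal 0 x) : x = [] := by
  rcases x with _ | ⟨o, x⟩
  · rfl
  · have := hx 0 (by simp)
    cases o <;> simp [Op.Allowed, size] at this

lemma take_succ_eq {x : List Op} {t : ℕ} (ht : t < x.length) :
    x.take (t + 1) = x.take t ++ [x[t]] := by
  simp

lemma DetAlg.cost_eq (D : DetAlg n m) {x : List Op} {t : ℕ} (ht : t < x.length) :
    D.cost x t = (x[t]).changes (size (x.take t)) (D.pos (x.take t)) (D.pos (x.take (t + 1))) := by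
  simp [DetAlg.cost, List.getElem?_eq_getElem ht, Op.moves_eq_changes]

lemma DetAlg.cost_append (D : DetAlg n m) (x l : List Op) {t : ℕ} (ht : t < x.length) :
    D.cost (x ++ l) t = D.cost x t := by
  rw [D.cost_eq ht, D.cost_eq (x := x ++ l) (by simp; omega), List.getElem_append_left ht,
    List.take_append_of_le_length ht.le, List.take_append_of_le_length ht]

lemma DetAlg.cost_append_singleton (D : DetAlg n m) (x : List Op) (o : Op) :
    D.cost (x ++ [o]) x.length = o.changes (size x) (D.pos x) (D.pos (x ++ [o])) := by
  rw [D.cost_eq (by simp)]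
  simp [List.take_of_length_le]

lemma DetAlg.cost_le (D : DetAlg n m) {x : List Op} (hx : Legal n x) (t : ℕ) : D.cost x t ≤ n := by
  by_cases ht : t < x.length
  · rw [D.cost_eq ht]
    refine (Op.changes_le_newSize _ _ _ _).trans ?_
    rw [← size_append_singleton, ← take_succ_eq ht]
    exact (hx.take _).size_le
  · simp [DetAlg.cost, List.getElem?_eq_none (not_lt.1 ht)]

end History

/-! ### Moving labels to their targets in a monotone order -/

section Advance

/-- If some label must go right, the last such one can: the labels after it are already at or beyond
their targets. Otherwise all remaining moves go left, and the first of them is free because all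
labels before it are in place. -/
lemma exists_advance_one {k : ℕ} {w v : ℕ → ℚ} (hw : StrictMonoOn w (Set.Iio k))
    (hv : StrictMonoOn v (Set.Iio k)) (hne : hamming k w v ≠ 0) :
    ∃ i < k, w i ≠ v i ∧ StrictMonoOn (Function.update w i (v i)) (Set.Iio k) := by
  by_cases hr : ∃ i < k, w i < v i
  · obtain ⟨i, hi, hmax⟩ := exists_max_image ({i ∈ range k | w i < v i} : Finset ℕ) id
      (by obtain ⟨i, hi⟩ := hr; exact ⟨i, by simpa using hi⟩)
    simp only [mem_filter, mem_range, id] at hi hmax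
    refine ⟨i, hi.1, hi.2.ne, fun a ha b hb hab => ?_⟩
    simp only [Set.mem_Iio] at ha hb
    simp only [Function.update_apply]
    split_ifs with h1 h2 h2
    · omega
    · subst h1
      refine (hv ha hb hab).trans_le (not_lt.1 fun h => ?_)
      have := hmax b ⟨hb, h⟩
      omega
    · subst h2
      exact (hw ha hb hab).trans hi.2
    · exact hw ha hb hab
  · push Not at hr
    obtain ⟨i, hi, hmin⟩ := exists_min_image ({i ∈ range k | w i ≠ v i} : Finset ℕ) id
      (card_ne_zero.1 hne)
    simp only [mem_filter, mem_range, id] at hi hmin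
    refine ⟨i, hi.1, hi.2, fun a ha b hb hab => ?_⟩
    simp only [Set.mem_Iio] at ha hb
    simp only [Function.update_apply]
    split_ifs with h1 h2 h2
    · omega
    · subst h1
      exact (hr a ha).trans_lt (hw ha hb hab)
    · subst h2
      have : w a = v a := by
        by_contra h
        have := hmin a ⟨ha, h⟩
        omega
      rw [this]
      exact hv ha hb hab
    · exact hw ha hb hab

/-- `w` is obtained from `u` by moving `m` labels to their places in `v`, in an order that keeps
the labels increasing. -/
lemma exists_advance {k : ℕ} {u v : ℕ → ℚ} (hu : StrictMonoOn u (Set.Iio k))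
    (hv : StrictMonoOn v (Set.Iio k)) (m : ℕ) :
    ∃ w : ℕ → ℚ, StrictMonoOn w (Set.Iio k) ∧ (∀ i, w i = u i ∨ w i = v i) ∧
      hamming k u w ≤ m ∧ hamming k w v ≤ hamming k u v - m := by
  induction m with
  | zero => exact ⟨u, hu, fun i => Or.inl rfl, by simp, by simp⟩
  | succ m ih =>
    obtain ⟨w, hw, huv, h1, h2⟩ := ih
    by_cases h0 : hamming k w v = 0
    · exact ⟨w, hw, huv, by omega, by omega⟩
    · obtain ⟨i, hi, hne, hmono⟩ := exists_advance_one hw hv h0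
      refine ⟨_, hmono, fun j => ?_, ?_, ?_⟩
      · simp only [Function.update_apply]
        split_ifs with h
        · exact Or.inr (by rw [h])
        · exact huv j
      · have := hamming_triangle k u w (Function.update w i (v i))
        have := hamming_update_self_le k w i (v i)
        omega
      · have := hamming_update k w v hi hne
        omega

end Advance

end ListLabeling

namespace ListLabeling

open Finset

/-! ### Changing the keys of the reliable algorithm -/

section Rearrange

variable {N m : ℕ}

lemma DetAlg.sum_cost_of_isPrefix (D : DetAlg N m) {h h' : List Op} (hp : h <+: h') (a : ℕ) :
    ∑ t ∈ Ico a h.length, D.cost h' t = ∑ t ∈ Ico a h.length, D.cost h t := by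
  obtain ⟨l, rfl⟩ := hp
  exact sum_congr rfl fun t ht => D.cost_append h l (mem_Ico.1 ht).2

/-- The history `h'` extends the history `h` of an algorithm of capacity `N` by at most `l`
operations that change the set of stored keys from `S` to `S'`, and keep the keys in `U`. -/
structure Rearrange (N : ℕ) (U : Finset ℚ) (h : List Op) (S : Finset ℚ) (h' : List Op)
    (S' : Finset ℚ) (l : ℕ) : Prop where
  isPrefix : h <+: h'
  length_le : h'.length ≤ h.length + l
  legal : Legal N h'
  size_eq : size h' = #S'
  subset : U ⊆ S'
  moved : ∀ (m : ℕ) (R : DetAlg N m),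
    #{y ∈ U | R.pos h (rank S y) ≠ R.pos h' (rank S' y)} ≤
      ∑ t ∈ Ico h.length h'.length, R.cost h' t

lemma Rearrange.refl {U S : Finset ℚ} {h : List Op} (hl : Legal N h) (hs : size h = #S)
    (hU : U ⊆ S) (l : ℕ) : Rearrange N U h S h S l where
  isPrefix := List.prefix_rfl
  length_le := Nat.le_add_right _ _
  legal := hl
  size_eq := hs
  subset := hU
  moved := by simp

lemma Rearrange.mono {U V S S' : Finset ℚ} {h h' : List Op} {l : ℕ}
    (H : Rearrange N V h S h' S' l) (hUV : U ⊆ V) : Rearrange N U h S h' S' l where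
  isPrefix := H.isPrefix
  length_le := H.length_le
  legal := H.legal
  size_eq := H.size_eq
  subset := hUV.trans H.subset
  moved := fun m R => (card_le_card (filter_subset_filter _ hUV)).trans (H.moved m R)

lemma Rearrange.trans {U S S' S'' : Finset ℚ} {h h' h'' : List Op} {l l' : ℕ}
    (H : Rearrange N U h S h' S' l) (H' : Rearrange N U h' S' h'' S'' l') :
    Rearrange N U h S h'' S'' (l + l') where
  isPrefix := H.isPrefix.trans H'.isPrefix
  length_le := by have := H.length_le; have := H'.length_le; omega
  legal := H'.legal
  size_eq := H'.size_eq
  subset := H'.subset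
  moved := fun m R => by
    rw [← sum_Ico_consecutive _ H.isPrefix.length_le H'.isPrefix.length_le,
      R.sum_cost_of_isPrefix H'.isPrefix]
    refine le_trans ?_ (Nat.add_le_add (H.moved m R) (H'.moved m R))
    refine (card_le_card ?_).trans (card_union_le _ _)
    intro y
    simp only [mem_filter, mem_union]
    grind

lemma rearrange_insert {U S : Finset ℚ} {h : List Op} {x : ℚ} (hl : Legal N h)
    (hs : size h = #S) (hU : U ⊆ S) (hx : x ∉ S) (hN : #S < N) :
    Rearrange N U h S (h ++ [.insert (rank S x)]) (insert x S) 1 where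
  isPrefix := List.prefix_append _ _
  length_le := by simp
  legal := legal_append_singleton.2 ⟨hl, by rw [hs]; exact rank_le_card S x, by rwa [hs]⟩
  size_eq := by simp [Op.newSize, hs, card_insert_of_notMem hx]
  subset := hU.trans (subset_insert _ _)
  moved := fun m R => by
    rw [show (h ++ [Op.insert (rank S x)]).length = h.length + 1 by simp, Nat.Ico_succ_singleton,
      sum_singleton, R.cost_append_singleton, hs]
    exact (card_le_card (filter_subset_filter _ hU)).trans (card_moved_insert_le hx _ _)

lemma rearrange_erase {U S : Finset ℚ} {h : List Op} {x : ℚ} (hl : Legal N h)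
    (hs : size h = #S) (hU : U ⊆ S) (hx : x ∈ S) (hxU : x ∉ U) :
    Rearrange N U h S (h ++ [.delete (rank S x)]) (S.erase x) 1 where
  isPrefix := List.prefix_append _ _
  length_le := by simp
  legal := legal_append_singleton.2 ⟨hl, by
    change _ < _; rw [hs]; exact rank_lt_card hx⟩
  size_eq := by simp [Op.newSize, hs, card_erase_of_mem hx]
  subset := subset_erase.2 ⟨hU, hxU⟩
  moved := fun m R => by
    rw [show (h ++ [Op.delete (rank S x)]).length = h.length + 1 by simp, Nat.Ico_succ_singleton,
      sum_singleton, R.cost_append_singleton, hs]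
    exact (card_le_card (filter_subset_filter _ (subset_erase.2 ⟨hU, hxU⟩))).trans
      (card_moved_erase_le hx _ _)

/-- When the capacity is exhausted, some stored key lies outside `U` and is evicted first; hence two
operations. -/
lemma exists_rearrange_insert {U S : Finset ℚ} {h : List Op} {x : ℚ} (hl : Legal N h)
    (hs : size h = #S) (hU : U ⊆ S) (hN : #U < N) (hx : x ∉ S) :
    ∃ h' S', Rearrange N U h S h' S' 2 ∧ x ∈ S' ∧ S' ⊆ insert x S := by
  by_cases hS : #S < N
  · have H := rearrange_insert hl hs hU hx hS
    exact ⟨_, _, ⟨H.isPrefix, H.length_le.trans (by omega), H.legal, H.size_eq, H.subset, H.moved⟩,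
      mem_insert_self _ _, Subset.rfl⟩
  · obtain ⟨z, hzS, hzU⟩ := exists_mem_notMem_of_card_lt_card (s := U) (t := S) (by omega)
    have H := rearrange_erase hl hs hU hzS hzU
    have hcard : #(S.erase z) < N := by
      have := hl.size_le
      rw [card_erase_of_mem hzS]
      omega
    refine ⟨_, _, H.trans (rearrange_insert H.legal H.size_eq H.subset
      (fun hm => hx (mem_of_mem_erase hm)) hcard), mem_insert_self _ _,
      insert_subset_insert _ (erase_subset _ _)⟩

end Rearrange

/-! ### Fresh keys for new elements -/

section Relabel

lemma Op.relabel_eq {o : Op} {n k : ℕ} (ho : o.Allowed n k) (x : ℚ) (f : ℕ → ℚ) {i : ℕ}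
    (hi : i < o.newSize k) :
    (o.weight = 1 ∧ o.relabel x f i = x) ∨ ∃ j < k, o.relabel x f i = f j := by
  cases o with
  | insert r =>
    simp only [Op.newSize] at hi
    have hr : r ≤ k := ho.1
    rcases lt_trichotomy i r with h | h | h
    · exact Or.inr ⟨i, by omega, by simp [Op.relabel, h]⟩
    · exact Or.inl ⟨rfl, by simp [Op.relabel, h]⟩
    · exact Or.inr ⟨i - 1, by omega, by simp [Op.relabel, h.not_gt, h.ne']⟩
  | delete r =>
    have hr : r < k := ho
    simp only [Op.newSize] at hi
    refine Or.inr ⟨skip r i, ?_, rfl⟩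
    have := skip_lt (r := r) hi
    omega

lemma exists_between_notMem {k r : ℕ} {f : ℕ → ℚ} (hf : StrictMonoOn f (Set.Iio k))
    (hr : r ≤ k) (S : Finset ℚ) :
    ∃ x ∉ S, (∀ i < r, f i < x) ∧ ∀ i, r ≤ i → i < k → x < f i := by
  have key : ∃ T : Set ℚ, T.Infinite ∧
      ∀ x ∈ T, (∀ i < r, f i < x) ∧ ∀ i, r ≤ i → i < k → x < f i := by
    have hle : ∀ i < r, f i ≤ f (r - 1) := fun i hi =>
      hf.monotoneOn (by simp; omega) (by simp; omega) (by omega)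
    have hge : ∀ i, r ≤ i → i < k → f r ≤ f i := fun i hi hk =>
      hf.monotoneOn (by simp; omega) (by simpa using hk) hi
    rcases Nat.eq_zero_or_pos r with h0 | h0
    · refine ⟨Set.Iio (f r), Set.Iio_infinite _, fun x hx => ⟨by omega, fun i hi hk => ?_⟩⟩
      exact lt_of_lt_of_le hx (hge i hi hk)
    · rcases hr.lt_or_eq with h | h
      · refine ⟨Set.Ioo (f (r - 1)) (f r), Set.Ioo_infinite
          (hf (by simp; omega) (by simpa using h) (by omega)), fun x hx => ⟨fun i hi => ?_,
          fun i hi hk => ?_⟩⟩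
        · exact lt_of_le_of_lt (hle i hi) hx.1
        · exact lt_of_lt_of_le hx.2 (hge i hi hk)
      · refine ⟨Set.Ioi (f (r - 1)), Set.Ioi_infinite _, fun x hx => ⟨fun i hi => ?_, by omega⟩⟩
        exact lt_of_le_of_lt (hle i hi) hx
  obtain ⟨T, hT, h⟩ := key
  obtain ⟨x, hxT, hxS⟩ := hT.exists_notMem_finset S
  exact ⟨x, hxS, h x hxT⟩

lemma Op.exists_relabel_strictMonoOn {o : Op} {n k : ℕ} (ho : o.Allowed n k) {f : ℕ → ℚ}
    (hf : StrictMonoOn f (Set.Iio k)) (S : Finset ℚ) :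
    ∃ x ∉ S, StrictMonoOn (o.relabel x f) (Set.Iio (o.newSize k)) := by
  cases o with
  | insert r =>
    obtain ⟨x, hxS, hlt, hgt⟩ := exists_between_notMem hf ho.1 S
    have hr : r ≤ k := ho.1
    refine ⟨x, hxS, fun a ha b hb hab => ?_⟩
    simp only [Op.newSize, Set.mem_Iio] at ha hb
    simp only [Op.relabel]
    split_ifs <;> first
      | omega
      | exact hlt _ (by omega)
      | exact hgt _ (by omega) (by omega)
      | exact hf (Set.mem_Iio.2 (by omega)) (Set.mem_Iio.2 (by omega)) (by omega)
  | delete r =>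
    obtain ⟨x, hx⟩ := Infinite.exists_notMem_finset S
    refine ⟨x, hx, fun a ha b hb hab => ?_⟩
    have hr : r < k := ho
    simp only [Op.newSize, Set.mem_Iio] at ha hb
    have h1 := skip_lt (r := r) ha
    have h2 := skip_lt (r := r) hb
    exact hf (by simp; omega) (by simp; omega) (skip_strictMono r hab)

end Relabel

/-! ### States, invariants and transitions -/

section State

/-- The keys `0, …, N - 1`, which stand for the slots of the array of the fast algorithm. -/
def slotKeys (N : ℕ) : Finset ℚ := (range N).image Nat.cast

/-- The keys of the slots together with the labels below `k` of two labelings. -/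
def usedKeys (N k : ℕ) (u v : ℕ → ℚ) : Finset ℚ :=
  slotKeys N ∪ ((range k).image u ∪ (range k).image v)

lemma card_slotKeys (N : ℕ) : #(slotKeys N) = N := by
  simp [slotKeys, card_image_of_injective _ (Nat.cast_injective (R := ℚ))]

lemma natCast_mem_slotKeys {N j : ℕ} (hj : j < N) : (j : ℚ) ∈ slotKeys N :=
  mem_image_of_mem _ (mem_range.2 hj)

lemma left_mem_usedKeys {N k i : ℕ} (hi : i < k) (u v : ℕ → ℚ) : u i ∈ usedKeys N k u v := by
  simp only [usedKeys, mem_union, mem_image, mem_range]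
  exact Or.inr (Or.inl ⟨i, hi, rfl⟩)

lemma right_mem_usedKeys {N k i : ℕ} (hi : i < k) (u v : ℕ → ℚ) : v i ∈ usedKeys N k u v := by
  simp only [usedKeys, mem_union, mem_image, mem_range]
  exact Or.inr (Or.inr ⟨i, hi, rfl⟩)

lemma slotKeys_subset_usedKeys (N k : ℕ) (u v : ℕ → ℚ) : slotKeys N ⊆ usedKeys N k u v :=
  subset_union_left

lemma usedKeys_subset {N k : ℕ} {u v : ℕ → ℚ} {S : Finset ℚ} (hS : slotKeys N ⊆ S)
    (hu : ∀ i < k, u i ∈ S) (hv : ∀ i < k, v i ∈ S) : usedKeys N k u v ⊆ S := by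
  refine union_subset hS (union_subset ?_ ?_) <;> intro x hx <;>
    obtain ⟨i, hi, rfl⟩ := mem_image.1 hx
  · exact hu i (mem_range.1 hi)
  · exact hv i (mem_range.1 hi)

lemma usedKeys_natCast {N k : ℕ} {u : ℕ → ℚ} {q : ℕ → ℕ} (hq : ∀ i < k, q i < N) :
    usedKeys N k u (fun i => q i) ⊆ usedKeys N k u u :=
  usedKeys_subset (slotKeys_subset_usedKeys _ _ _ _) (fun _ hi => left_mem_usedKeys hi _ _)
    fun i hi => slotKeys_subset_usedKeys _ _ _ _ (natCast_mem_slotKeys (hq i hi))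

lemma usedKeys_relabel {o : Op} {n k : ℕ} (ho : o.Allowed n k) (N : ℕ) (x y : ℚ) (u v : ℕ → ℚ) :
    usedKeys N (o.newSize k) (o.relabel x u) (o.relabel y v) ⊆
      if o.weight = 1 then insert x (insert y (usedKeys N k u v)) else usedKeys N k u v := by
  refine usedKeys_subset ?_ (fun i hi => ?_) fun i hi => ?_
  · have := slotKeys_subset_usedKeys N k u v
    split_ifs
    · exact this.trans ((subset_insert _ _).trans (subset_insert _ _))
    · exact this
  · rcases Op.relabel_eq ho x u hi with ⟨h1, h2⟩ | ⟨j, hj, h2⟩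
    · simp [h1, h2]
    · have := left_mem_usedKeys (N := N) hj u v
      rw [h2]
      split_ifs <;> simp [this]
  · rcases Op.relabel_eq ho y v hi with ⟨h1, h2⟩ | ⟨j, hj, h2⟩
    · simp [h1, h2]
    · have := right_mem_usedKeys (N := N) hj u v
      rw [h2]
      split_ifs <;> simp [this]

lemma card_usedKeys_relabel_le {o : Op} {n k : ℕ} (ho : o.Allowed n k) (N : ℕ) (x y : ℚ)
    (u v : ℕ → ℚ) :
    #(usedKeys N (o.newSize k) (o.relabel x u) (o.relabel y v)) ≤ #(usedKeys N k u v) + 2 := by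
  refine (card_le_card (usedKeys_relabel ho N x y u v)).trans ?_
  have h1 := card_insert_le x (insert y (usedKeys N k u v))
  have h2 := card_insert_le y (usedKeys N k u v)
  split_ifs <;> omega

lemma card_usedKeys_relabel_self_le {o : Op} {n k : ℕ} (ho : o.Allowed n k) (N : ℕ) (y : ℚ)
    (v : ℕ → ℚ) :
    #(usedKeys N (o.newSize k) (o.relabel y v) (o.relabel y v)) ≤ #(usedKeys N k v v) + 1 := by
  refine (card_le_card (usedKeys_relabel ho N y y v v)).trans ?_
  have h2 := card_insert_le y (usedKeys N k v v)
  split_ifs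
  · simpa using h2
  · omega

/-- The state of the combined algorithm. The reliable algorithm has performed the operations
`hist` and stores the keys `keys`. The stored elements have the keys `cur`, and are being moved to
the keys `tgt`. There were `age` operations since the target was set. -/
structure State where
  hist : List Op
  keys : Finset ℚ
  cur : ℕ → ℚ
  tgt : ℕ → ℚ
  age : ℕ

/-- The slots of the elements in the array of the reliable algorithm. -/
def State.slots {N m : ℕ} (R : DetAlg N m) (s : State) (i : ℕ) : ℕ :=
  R.pos s.hist (rank s.keys (s.cur i))

/-- The invariants of a state with `k` elements, if `b` is the rate of the rebuilding. -/
structure State.Valid (n e b k : ℕ) (s : State) : Prop where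
  legal : Legal (n + 2 * e) s.hist
  size_eq : size s.hist = #s.keys
  subset : usedKeys (n + e) k s.cur s.tgt ⊆ s.keys
  cur_mono : StrictMonoOn s.cur (Set.Iio k)
  tgt_mono : StrictMonoOn s.tgt (Set.Iio k)
  card_used_le : #(usedKeys (n + e) k s.cur s.tgt) ≤ n + e + (e + 7) / 8 + 2 * s.age
  card_tgt_le : #(usedKeys (n + e) k s.tgt s.tgt) ≤ n + e + s.age
  work_le : s.age * b + hamming k s.cur s.tgt ≤ n
  age_pos : s.age = 0 ∨ 0 < hamming k s.cur s.tgt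

/-- The potential of a state when the fast algorithm has its `k` elements in the slots `p`. -/
def State.potential (k : ℕ) (p : ℕ → ℕ) (s : State) : ℕ :=
  2 * hamming k s.cur s.tgt + 3 * hamming k s.tgt fun i => p i

/-- The properties of a transition from `s` to `s'` when the operation `o` is performed with `k`
elements and the fast algorithm moves its elements from `p` to `q`. The cost of the transition is
at most `c` plus the cost of the operations of the reliable algorithm. -/
structure State.Step (n e b k : ℕ) (o : Op) (p q : ℕ → ℕ) (s s' : State) (c : ℕ) : Prop where
  valid : s'.Valid n e b (o.newSize k)
  isPrefix : s.hist <+: s'.hist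
  length_le : s'.hist.length ≤ s.hist.length + 4
  length_mul_le : (s'.hist.length - s.hist.length) * (b + 1) ≤ 4 * c
  cost_le : c ≤ b + 2
  potential_le : c + s'.potential (o.newSize k) q ≤ s.potential k p + 6 * o.changes k p q
  changes_le : ∀ (m : ℕ) (R : DetAlg (n + 2 * e) m), o.changes k (s.slots R) (s'.slots R) ≤
    c + ∑ t ∈ Ico s.hist.length s'.hist.length, R.cost s'.hist t

variable {n e b k : ℕ} {o : Op} {p q : ℕ → ℕ} {s : State}

lemma State.changes_direct_le (ho : o.Allowed n k) (p q : ℕ → ℕ) (s : State) :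
    o.changes k s.cur (fun i => (q i : ℚ)) ≤
      hamming k s.cur s.tgt + hamming k s.tgt (fun i => p i) + o.changes k p q := by
  have h1 := Op.changes_le_hamming_add ho s.cur s.tgt fun i => (q i : ℚ)
  have h2 := Op.changes_le_hamming_add ho s.tgt (fun i => (p i : ℚ)) fun i => (q i : ℚ)
  have h3 := o.changes_comp_le k (Nat.cast (R := ℚ)) p q
  omega

/-- The slot keys are always stored, so `R` performs no operation. The new potential is zero, and
the old one pays for the direct move by the triangle inequality. -/
lemma State.Valid.exists_fast_step (hs : s.Valid n e b k) (ho : o.Allowed n k)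
    (hq : StrictMonoOn q (Set.Iio (o.newSize k))) (hqlt : ∀ i < o.newSize k, q i < n + e)
    (hd : o.changes k s.cur (fun i => (q i : ℚ)) ≤ b + 1) :
    ∃ s' c, s.Step n e b k o p q s' c := by
  have hmono : StrictMonoOn (fun i => (q i : ℚ)) (Set.Iio (o.newSize k)) :=
    fun i hi j hj hij => Nat.cast_lt.2 (hq hi hj hij)
  have hused : usedKeys (n + e) (o.newSize k) (fun i => (q i : ℚ)) (fun i => q i) ⊆
      slotKeys (n + e) :=
    usedKeys_subset Subset.rfl (fun i hi => natCast_mem_slotKeys (hqlt i hi))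
      fun i hi => natCast_mem_slotKeys (hqlt i hi)
  have hcard := card_le_card hused
  rw [card_slotKeys] at hcard
  refine ⟨⟨s.hist, s.keys, fun i => q i, fun i => q i, 0⟩,
    o.changes k s.cur (fun i => (q i : ℚ)), ?_⟩
  constructor
  · exact ⟨hs.legal, hs.size_eq,
      hused.trans ((slotKeys_subset_usedKeys _ _ _ _).trans hs.subset), hmono, hmono,
      by dsimp only; omega, by dsimp only; omega, by simp, Or.inl rfl⟩
  · exact List.prefix_rfl
  · simp
  · simp
  · omega
  · have := s.changes_direct_le ho p q
    simp only [State.potential, hamming_self]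
    omega
  · intro m R
    refine le_trans ?_ (Nat.le_add_right _ _)
    exact o.changes_comp_le k (fun x => R.pos s.hist (rank s.keys x)) s.cur fun i => (q i : ℚ)

lemma State.Valid.exists_relabel (hs : s.Valid n e b k) (ho : o.Allowed n k)
    (hroom : #(usedKeys (n + e) k s.cur s.tgt) + 1 < n + 2 * e) :
    ∃ h' S' x y, Rearrange (n + 2 * e) (usedKeys (n + e) k s.cur s.tgt) s.hist s.keys h' S' 4 ∧
      usedKeys (n + e) (o.newSize k) (o.relabel x s.cur) (o.relabel y s.tgt) ⊆ S' ∧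
      StrictMonoOn (o.relabel x s.cur) (Set.Iio (o.newSize k)) ∧
      StrictMonoOn (o.relabel y s.tgt) (Set.Iio (o.newSize k)) := by
  obtain ⟨x, hx, hxm⟩ := Op.exists_relabel_strictMonoOn ho hs.cur_mono s.keys
  obtain ⟨y, hy, hym⟩ := Op.exists_relabel_strictMonoOn ho hs.tgt_mono (insert x s.keys)
  have hused := usedKeys_relabel ho (n + e) x y s.cur s.tgt
  by_cases hw : o.weight = 1
  · rw [if_pos hw] at hused
    obtain ⟨h₁, S₁, H₁, hx₁, hS₁⟩ :=
      exists_rearrange_insert hs.legal hs.size_eq hs.subset (by omega) hx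
    -- The second insertion must also protect `x`, which explains the `+ 1` in `hroom`.
    obtain ⟨h₂, S₂, H₂, hy₂, -⟩ := exists_rearrange_insert H₁.legal H₁.size_eq
      (insert_subset hx₁ H₁.subset) ((card_insert_le _ _).trans_lt hroom)
      (fun h => hy (hS₁ h))
    refine ⟨h₂, S₂, x, y, H₁.trans (H₂.mono (subset_insert _ _)), hused.trans ?_, hxm, hym⟩
    exact insert_subset (H₂.subset (mem_insert_self _ _))
      (insert_subset hy₂ ((subset_insert _ _).trans H₂.subset))
  · rw [if_neg hw] at hused
    exact ⟨s.hist, s.keys, x, y, Rearrange.refl hs.legal hs.size_eq hs.subset 4,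
      hused.trans hs.subset, hxm, hym⟩

/-- An unfinished rebuilding has positive distance left, so `age * b < n`, whereas `8 * n ≤ b * e`.
-/
lemma State.Valid.age_lt (hs : s.Valid n e b k) (he : 0 < e) (hb : 8 * n ≤ b * e) :
    8 * s.age < e := by
  rcases hs.age_pos with h | h
  · omega
  · by_contra hlt
    have h1 := hs.work_le
    have h2 : e * b ≤ 8 * s.age * b := Nat.mul_le_mul_right b (by omega)
    nlinarith

/-- The age bound leaves room for two fresh keys. A move is charged to `R` if it keeps the key and
changes its slot, and to `c` if it changes the key: `b + 1` for the advance and one for a new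
element. -/
lemma State.Valid.exists_slow_step (hs : s.Valid n e b k) (ho : o.Allowed n k)
    (hq : StrictMonoOn q (Set.Iio (o.newSize k))) (hqlt : ∀ i < o.newSize k, q i < n + e)
    (hn : o.newSize k ≤ n) (hb : 8 * n ≤ b * e)
    (hd : b + 1 < o.changes k s.cur (fun i => (q i : ℚ))) :
    ∃ s' c, s.Step n e b k o p q s' c := by
  have hbn : b + 1 < n := hd.trans_le ((o.changes_le_newSize _ _ _).trans hn)
  -- With `e ≤ 8`, the rate condition would give `n ≤ b`.
  have he : 8 < e := by
    by_contra h
    have : b * e ≤ b * 8 := Nat.mul_le_mul_left b (by omega)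
    omega
  have hage := hs.age_lt (by omega) hb
  have hused := hs.card_used_le
  obtain ⟨h', S', x, y, H, hsub, hxm, hym⟩ := hs.exists_relabel ho (by omega)
  obtain ⟨w, hwm, hw, hw1, hw2⟩ := exists_advance hxm hym (b + 1)
  have hwsub : usedKeys (n + e) (o.newSize k) w (o.relabel y s.tgt) ⊆
      usedKeys (n + e) (o.newSize k) (o.relabel x s.cur) (o.relabel y s.tgt) := by
    refine usedKeys_subset (slotKeys_subset_usedKeys _ _ _ _) (fun i hi => ?_)
      fun i hi => right_mem_usedKeys hi _ _
    rcases hw i with h | h <;> rw [h]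
    · exact left_mem_usedKeys hi _ _
    · exact right_mem_usedKeys hi _ _
  have hwt := o.weight_le_changes k p q
  have hwt1 := o.weight_le_one
  have hU : hamming (o.newSize k) (o.relabel x s.cur) (o.relabel y s.tgt) ≤
      hamming k s.cur s.tgt + o.weight := by
    refine (Op.hamming_relabel_le ho _ _ _).trans
      ((Op.changes_le_hamming_add ho _ s.tgt _).trans ?_)
    rw [Op.changes_relabel]
  have hV : hamming (o.newSize k) (o.relabel y s.tgt) (fun i => (q i : ℚ)) ≤
      hamming k s.tgt (fun i => (p i : ℚ)) + o.changes k p q :=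
    (Op.hamming_relabel_le ho _ _ _).trans ((Op.changes_le_hamming_add ho _ _ _).trans
      (Nat.add_le_add_left (o.changes_comp_le k (Nat.cast (R := ℚ)) p q) _))
  have hdirect := s.changes_direct_le ho p q
  have hwork := hs.work_le
  have hlen := H.length_le
  have hmul : (h'.length - s.hist.length) * (b + 1) ≤ 4 * (b + 1 + o.weight) :=
    Nat.mul_le_mul (by omega) (by omega)
  have hcost : ∀ (m : ℕ) (R : DetAlg (n + 2 * e) m), o.changes k (s.slots R)
      (fun i => R.pos h' (rank S' (w i))) ≤ b + 1 + o.weight +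
        ∑ t ∈ Ico s.hist.length h'.length, R.cost h' t := by
    intro m R
    have h1 := Op.changes_le_hamming_add ho (s.slots R)
      (fun i => R.pos h' (rank S' (s.cur i))) fun i => R.pos h' (rank S' (w i))
    have h2 := o.changes_comp_le k (fun z => R.pos h' (rank S' z)) s.cur w
    have h3 := o.changes_le_add_hamming k s.cur (o.relabel x s.cur) w
    rw [Op.changes_relabel] at h3
    -- Distinct elements have distinct current keys, all protected by the rearrangement.
    have h4 : hamming k (s.slots R) (fun i => R.pos h' (rank S' (s.cur i))) ≤
        #{z ∈ usedKeys (n + e) k s.cur s.tgt |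
          R.pos s.hist (rank s.keys z) ≠ R.pos h' (rank S' z)} := by
      refine card_le_card_of_injOn s.cur ?_
        (hs.cur_mono.injOn.mono fun i hi => mem_range.1 (mem_filter.1 (mem_coe.1 hi)).1)
      intro i
      simp only [coe_filter, mem_range, Set.mem_ofPred_eq]
      exact fun hi => ⟨left_mem_usedKeys hi.1 _ _, hi.2⟩
    have h5 := H.moved m R
    omega
  have hcardw := (card_le_card hwsub).trans (card_usedKeys_relabel_le ho (n + e) x y s.cur s.tgt)
  have hcardt := card_usedKeys_relabel_self_le ho (n + e) y s.tgt
  have htgt := hs.card_tgt_le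
  by_cases hdone : hamming (o.newSize k) w (o.relabel y s.tgt) = 0
  · have hweq := eq_of_hamming_eq_zero hdone
    -- At completion current and target keys agree, so each element uses one key beyond the slot
    -- keys at most. This halves the growth and lets the count restart at `n + e + (e + 7) / 8`.
    have hsub' : usedKeys (n + e) (o.newSize k) w (fun i => q i) ⊆
        usedKeys (n + e) (o.newSize k) (o.relabel y s.tgt) (o.relabel y s.tgt) := by
      refine (usedKeys_natCast hqlt).trans
        (usedKeys_subset (slotKeys_subset_usedKeys _ _ _ _) ?_ ?_) <;>
        exact fun i hi => by rw [hweq i hi]; exact left_mem_usedKeys hi _ _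
    have hslots : usedKeys (n + e) (o.newSize k) (fun i => (q i : ℚ)) (fun i => q i) ⊆
        slotKeys (n + e) :=
      usedKeys_subset Subset.rfl (fun i hi => natCast_mem_slotKeys (hqlt i hi))
        fun i hi => natCast_mem_slotKeys (hqlt i hi)
    have hcards := card_le_card hslots
    rw [card_slotKeys] at hcards
    have hcard' := card_le_card hsub'
    have hhq : hamming (o.newSize k) w (fun i => (q i : ℚ)) =
        hamming (o.newSize k) (o.relabel y s.tgt) (fun i => (q i : ℚ)) :=
      hamming_congr hweq fun _ _ => rfl
    refine ⟨⟨h', S', w, fun i => q i, 0⟩, b + 1 + o.weight, ?_, H.isPrefix, hlen, hmul,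
      by omega, ?_, hcost⟩
    -- The bound on used keys needs `age + 1 ≤ (e + 7) / 8`, which is `8 * age < e`.
    · refine ⟨H.legal, H.size_eq, ?_, hwm, fun i hi j hj hij => Nat.cast_lt.2 (hq hi hj hij),
        by dsimp only; omega, by dsimp only; omega, ?_, Or.inl rfl⟩
      · refine hsub'.trans (Subset.trans ?_ hsub)
        exact usedKeys_subset (slotKeys_subset_usedKeys _ _ _ _)
          (fun i hi => right_mem_usedKeys hi _ _) fun i hi => right_mem_usedKeys hi _ _
      · simpa using (hamming_le _ _ _).trans hn
    -- The distance from target to `F` now has weight 2 instead of 3. This drop and the former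
    -- distance to the target pay for `b + 1`, which is below the direct cost.
    · simp only [State.potential, hamming_self, hhq]
      omega
  · refine ⟨⟨h', S', w, o.relabel y s.tgt, s.age + 1⟩, b + 1 + o.weight, ?_, H.isPrefix, hlen,
      hmul, by omega, ?_, hcost⟩
    · refine ⟨H.legal, H.size_eq, hwsub.trans hsub, hwm, hym, by dsimp only; omega,
        by dsimp only; omega, ?_, Or.inr (Nat.pos_of_ne_zero hdone)⟩
      dsimp only
      -- The distance is still nonzero, so the subtraction in `hw2` is not truncated: it drops by `b
      -- + 1` after growing by at most one.
      rw [add_mul, one_mul]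
      omega
    · simp only [State.potential]
      omega

lemma State.Valid.exists_step (hs : s.Valid n e b k) (ho : o.Allowed n k)
    (hq : StrictMonoOn q (Set.Iio (o.newSize k))) (hqlt : ∀ i < o.newSize k, q i < n + e)
    (hn : o.newSize k ≤ n) (hb : n ≤ b ∨ 8 * n ≤ b * e) :
    ∃ s' c, s.Step n e b k o p q s' c := by
  by_cases hd : o.changes k s.cur (fun i => (q i : ℚ)) ≤ b + 1
  · exact hs.exists_fast_step ho hq hqlt hd
  · have := (o.changes_le_newSize k s.cur (fun i => (q i : ℚ))).trans hn
    exact hs.exists_slow_step ho hq hqlt hn (hb.resolve_left (by omega)) (by omega)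

end State

end ListLabeling

namespace ListLabeling

open Finset

/-! ### The combined algorithm and its pathwise cost -/

section Combination

/-- The positions of the at most `n` stored elements, with irrelevant values removed. -/
def DetAlg.posBelow {n m : ℕ} (F : DetAlg n m) (h : List Op) (i : ℕ) : ℕ :=
  if i < n then F.pos h i else 0

lemma DetAlg.posBelow_eq {n m : ℕ} (F : DetAlg n m) {h : List Op} (hl : Legal n h) {i : ℕ}
    (hi : i < size h) : F.posBelow h i = F.pos h i :=
  if_pos (hi.trans_le hl.size_le)

lemma DetAlg.cost_eq_posBelow {n m : ℕ} (F : DetAlg n m) {x : List Op} (hx : Legal n x) {t : ℕ}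
    (ht : t < x.length) :
    F.cost x t = (x[t]).changes (size (x.take t)) (F.posBelow (x.take t))
      (F.posBelow (x.take (t + 1))) := by
  rw [F.cost_eq ht]
  refine Op.changes_congr (hx t ht) (fun i hi => (F.posBelow_eq (hx.take t) hi).symm)
    fun i hi => (F.posBelow_eq (hx.take (t + 1)) ?_).symm
  rwa [take_succ_eq ht, size_append_singleton]

/-- The initial state: the reliable algorithm stores the keys of the slots. -/
def State.init (n e : ℕ) : State where
  hist := List.replicate (n + e) (.insert 0)
  keys := slotKeys (n + e)
  cur := fun i => i
  tgt := fun i => i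
  age := 0

lemma legal_replicate_insert {N : ℕ} (k : ℕ) (hk : k ≤ N) :
    Legal N (List.replicate k (.insert 0)) ∧ size (List.replicate k (.insert 0)) = k := by
  induction k with
  | zero => exact ⟨legal_nil, rfl⟩
  | succ k ih =>
    obtain ⟨h1, h2⟩ := ih (by omega)
    rw [List.replicate_succ', legal_append_singleton, size_append_singleton, h2]
    exact ⟨⟨h1, Nat.zero_le _, hk⟩, rfl⟩

lemma State.init_valid (n e b : ℕ) : (State.init n e).Valid n e b 0 := by
  obtain ⟨h1, h2⟩ := legal_replicate_insert (N := n + 2 * e) (n + e) (by omega)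
  have hsub : usedKeys (n + e) 0 (State.init n e).cur (State.init n e).tgt ⊆ slotKeys (n + e) :=
    usedKeys_subset Subset.rfl (by omega) (by omega)
  have hcard := card_le_card hsub
  rw [card_slotKeys] at hcard
  exact ⟨h1, by rw [State.init, h2, card_slotKeys], hsub, by simp [StrictMonoOn],
    by simp [StrictMonoOn], by omega, by simpa [State.init] using hcard, by simp [State.init],
    Or.inl rfl⟩

open Classical in
/-- The state after the operation `o`. -/
noncomputable def State.next (n e b k : ℕ) (o : Op) (p q : ℕ → ℕ) (s : State) : State :=
  if H : ∃ s' c, s.Step n e b k o p q s' c then H.choose else s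

/-- The state after the operations of a list, the last one first. -/
noncomputable def stateRev (n e b : ℕ) (F : DetAlg n (n + e)) : List Op → State
  | [] => State.init n e
  | o :: l => (stateRev n e b F l).next n e b (size l.reverse) o (F.posBelow l.reverse)
      (F.posBelow (l.reverse ++ [o]))

/-- The state after the operations `h`. -/
noncomputable def stateAfter (n e b : ℕ) (F : DetAlg n (n + e)) (h : List Op) : State :=
  stateRev n e b F h.reverse

variable {n e b : ℕ}

lemma stateAfter_append (F : DetAlg n (n + e)) (h : List Op) (o : Op) :
    stateAfter n e b F (h ++ [o]) = (stateAfter n e b F h).next n e b (size h) o (F.posBelow h)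
      (F.posBelow (h ++ [o])) := by
  simp [stateAfter, stateRev]

/-- The state depends on finitely many positions of `F`; this yields measurability although
transitions are selected by choice. -/
lemma stateAfter_congr {F F' : DetAlg n (n + e)} {h : List Op}
    (H : ∀ t ≤ h.length, F.posBelow (h.take t) = F'.posBelow (h.take t)) :
    stateAfter n e b F h = stateAfter n e b F' h := by
  induction h using List.reverseRecOn with
  | nil => rfl
  | append_singleton h o ih =>
    have h1 : ∀ t ≤ h.length, F.posBelow (h.take t) = F'.posBelow (h.take t) := fun t ht => by
      have := H t (by simp; omega)
      rwa [List.take_append_of_le_length ht] at this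
    have h2 := h1 h.length le_rfl
    have h3 := H (h ++ [o]).length le_rfl
    rw [List.take_length] at h2 h3
    rw [stateAfter_append, stateAfter_append, ih h1, h2, h3]

lemma step_of_valid (hb : n ≤ b ∨ 8 * n ≤ b * e) (F : DetAlg n (n + e)) {h : List Op} {o : Op}
    (hl : Legal n (h ++ [o])) (hv : (stateAfter n e b F h).Valid n e b (size h)) :
    ∃ c, (stateAfter n e b F h).Step n e b (size h) o (F.posBelow h) (F.posBelow (h ++ [o]))
      (stateAfter n e b F (h ++ [o])) c := by
  have hsize := size_append_singleton h o
  have H := hv.exists_step (q := F.posBelow (h ++ [o])) (p := F.posBelow h) (o := o)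
    (legal_append_singleton.1 hl).2
    (fun i hi j hj hij => by
      rw [← hsize] at hi hj
      rw [F.posBelow_eq hl hi, F.posBelow_eq hl hj]
      exact F.sorted _ hl i j hij hj)
    (fun i hi => by
      rw [← hsize] at hi
      rw [F.posBelow_eq hl hi]
      exact F.pos_lt _ hl i hi)
    (hsize ▸ hl.size_le) hb
  rw [stateAfter_append, State.next, dif_pos H]
  exact H.choose_spec

lemma stateAfter_valid (hb : n ≤ b ∨ 8 * n ≤ b * e) (F : DetAlg n (n + e)) {h : List Op}
    (hl : Legal n h) : (stateAfter n e b F h).Valid n e b (size h) := by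
  induction h using List.reverseRecOn with
  | nil => exact State.init_valid n e b
  | append_singleton h o ih =>
    obtain ⟨c, hc⟩ := step_of_valid hb F hl (ih (legal_append_singleton.1 hl).1)
    rw [size_append_singleton]
    exact hc.valid

/-- The combination of the fast algorithm `F` and the reliable algorithm `R`. -/
noncomputable def combineDet {m : ℕ} (hb : n ≤ b ∨ 8 * n ≤ b * e) (F : DetAlg n (n + e))
    (R : DetAlg (n + 2 * e) m) : DetAlg n m where
  pos h := (stateAfter n e b F h).slots R
  pos_lt h hl i hi := by
    have hv := stateAfter_valid hb F hl
    refine R.pos_lt _ hv.legal _ ?_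
    rw [hv.size_eq]
    exact rank_lt_card (hv.subset (left_mem_usedKeys hi _ _))
  sorted h hl i j hij hj := by
    have hv := stateAfter_valid hb F hl
    refine R.sorted _ hv.legal _ _ ?_ ?_
    · exact rank_lt_rank (hv.subset (left_mem_usedKeys (hij.trans hj) _ _))
        (hv.cur_mono (hij.trans hj) hj hij)
    · rw [hv.size_eq]
      exact rank_lt_card (hv.subset (left_mem_usedKeys hj _ _))

/-- The cost of the combination on a part of an input sequence, compared with the costs of the two
algorithms. -/
structure WindowCost (hb : n ≤ b ∨ 8 * n ≤ b * e) (F : DetAlg n (n + e)) (x : List Op)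
    (i j : ℕ) (c : ℕ) : Prop where
  isPrefix : (stateAfter n e b F (x.take i)).hist <+: (stateAfter n e b F (x.take j)).hist
  length_le : (stateAfter n e b F (x.take j)).hist.length ≤
    (stateAfter n e b F (x.take i)).hist.length + 4 * (j - i)
  length_mul_le : ((stateAfter n e b F (x.take j)).hist.length -
    (stateAfter n e b F (x.take i)).hist.length) * (b + 1) ≤ 4 * c
  cost_le : c ≤ (j - i) * (b + 2)
  potential_le : c + (stateAfter n e b F (x.take j)).potential (size (x.take j))
      (F.posBelow (x.take j)) ≤
    (stateAfter n e b F (x.take i)).potential (size (x.take i)) (F.posBelow (x.take i)) +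
      6 * ∑ t ∈ Ico i j, F.cost x t
  sum_le : ∀ (m : ℕ) (R : DetAlg (n + 2 * e) m), ∑ t ∈ Ico i j, (combineDet hb F R).cost x t ≤
    c + ∑ t ∈ Ico (stateAfter n e b F (x.take i)).hist.length
      (stateAfter n e b F (x.take j)).hist.length, R.cost (stateAfter n e b F (x.take j)).hist t

lemma exists_windowCost (hb : n ≤ b ∨ 8 * n ≤ b * e) (F : DetAlg n (n + e)) {x : List Op}
    (hx : Legal n x) {i j : ℕ} (hij : i ≤ j) (hj : j ≤ x.length) :
    ∃ c, WindowCost hb F x i j c := by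
  induction j, hij using Nat.le_induction with
  | base => exact ⟨0, List.prefix_rfl, by simp, by simp, by simp, by simp, by simp⟩
  | succ j hij ih =>
    obtain ⟨c, H⟩ := ih (by omega)
    have hj' : j < x.length := hj
    have hl := hx.take (j + 1)
    rw [take_succ_eq hj'] at hl
    obtain ⟨d, D⟩ := step_of_valid hb F hl (stateAfter_valid hb F (hx.take j))
    have hF := F.cost_eq_posBelow hx hj'
    have hsize : size (x.take (j + 1)) = x[j].newSize (size (x.take j)) := by
      rw [take_succ_eq hj', size_append_singleton]
    rw [← take_succ_eq hj'] at D
    have h1 := H.isPrefix.length_le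
    have h2 := D.isPrefix.length_le
    refine ⟨c + d, H.isPrefix.trans D.isPrefix, ?_, ?_, ?_, ?_, fun m R => ?_⟩
    · have := H.length_le; have := D.length_le; omega
    · have h3 := H.length_mul_le; have h4 := D.length_mul_le
      rw [← Nat.sub_add_sub_cancel h2 h1, add_mul]
      omega
    · have h3 := H.cost_le; have h4 := D.cost_le
      rw [Nat.succ_sub hij, Nat.succ_mul]
      omega
    · have h3 := H.potential_le; have h4 := D.potential_le
      rw [sum_Ico_succ_top hij, hF, hsize]
      omega
    · have h3 := H.sum_le m R; have h4 := D.changes_le m R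
      rw [sum_Ico_succ_top hij, ← sum_Ico_consecutive _ h1 h2, R.sum_cost_of_isPrefix D.isPrefix,
        DetAlg.cost_eq _ hj']
      exact (Nat.add_le_add h3 h4).trans_eq (by ring)

/-- The initial potential is at most `2 * n + 3 * n`, and the final one is dropped. -/
lemma WindowCost.cost_le_of_potential {hb : n ≤ b ∨ 8 * n ≤ b * e} {F : DetAlg n (n + e)}
    {x : List Op} (hx : Legal n x) {i j c : ℕ} (H : WindowCost hb F x i j c) :
    c ≤ 5 * n + 6 * ∑ t ∈ Ico i j, F.cost x t := by
  have h1 := H.potential_le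
  have h2 := (hx.take i).size_le
  have h3 := hamming_le (size (x.take i)) (stateAfter n e b F (x.take i)).cur
    (stateAfter n e b F (x.take i)).tgt
  have h4 := hamming_le (size (x.take i)) (stateAfter n e b F (x.take i)).tgt
    fun l => (F.posBelow (x.take i) l : ℚ)
  simp only [State.potential] at h1
  omega

end Combination

namespace Alg

open MeasureTheory

/-! ### Expected costs and lower bounds on them -/

section Cost

variable {n m : ℕ} (L : Alg n m)

lemma measurable_cost (x : List Op) (t : ℕ) : Measurable fun ω => (L.run ω).cost x t := by
  by_cases ht : t < x.length
  · have key : ∀ h h' i i', Measurable fun ω =>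
        if (L.run ω).pos h i ≠ (L.run ω).pos h' i' then 1 else 0 := fun h h' i i' =>
      Measurable.ite (measurableSet_eq_fun (L.measurable_pos h i) (L.measurable_pos h' i')).compl
        measurable_const measurable_const
    simp only [DetAlg.cost_eq _ ht]
    rcases x[t] with r | r <;> simp only [Op.changes, hamming, card_filter]
    · exact (Finset.measurable_sum _ fun i _ => key _ _ _ _).const_add 1
    · exact Finset.measurable_sum _ fun i _ => key _ _ _ _
  · simp [DetAlg.cost, List.getElem?_eq_none (not_lt.1 ht)]

lemma integrable_sum_cost {x : List Op} (hx : Legal n x) (s : Finset ℕ) :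
    Integrable (fun ω => ∑ t ∈ s, ((L.run ω).cost x t : ℝ)) L.μ := by
  refine integrable_finsetSum _ fun t _ => ?_
  refine Integrable.of_bound (C := n)
    (measurable_from_top.comp (L.measurable_cost x t)).aestronglyMeasurable ?_
  exact Filter.Eventually.of_forall fun ω => by
    simpa using (L.run ω).cost_le hx t

lemma le_expCost {x : List Op} (hx : Legal n x) {i j c : ℕ}
    (H : ∀ ω, c ≤ ∑ t ∈ Ico i j, (L.run ω).cost x t) : (c : ℝ) ≤ L.expCost x i j := by
  have : ∫ _, (c : ℝ) ∂L.μ ≤ L.expCost x i j :=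
    integral_mono (integrable_const _) (L.integrable_sum_cost hx _) fun ω => by
      dsimp only
      exact_mod_cast H ω
  simpa using this

lemma expCost_le {x : List Op} (hx : Legal n x) {i j : ℕ} {c : ℝ}
    (H : ∀ ω, ∑ t ∈ Ico i j, ((L.run ω).cost x t : ℝ) ≤ c) : L.expCost x i j ≤ c := by
  have : L.expCost x i j ≤ ∫ _, c ∂L.μ :=
    integral_mono (L.integrable_sum_cost hx _) (integrable_const _) H
  simpa using this

lemma WorstCase.expCost_le {L : Alg n m} {W : ℝ} (hW : L.WorstCase W)
    {x : List Op} (hx : Legal n x) {i j : ℕ}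
    (hij : i ≤ j) (hj : j ≤ x.length) : L.expCost x i j ≤ ((j : ℝ) - i) * W := by
  refine L.expCost_le hx fun ω => ?_
  calc ∑ t ∈ Ico i j, ((L.run ω).cost x t : ℝ) ≤ ∑ t ∈ Ico i j, W :=
        sum_le_sum fun t ht => hW x hx t ((mem_Ico.1 ht).2.trans_le hj) ω
    _ = ((j : ℝ) - i) * W := by simp [Nat.cast_sub hij]

lemma _root_.ListLabeling.DetAlg.one_le_cost_zero {n m : ℕ} (D : DetAlg n m) {x : List Op}
    (hx : Legal n x) (h0 : 0 < x.length) : 1 ≤ D.cost x 0 := by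
  rw [D.cost_eq h0]
  have hallowed := hx 0 h0
  generalize x[0] = o at hallowed
  rcases o with r | r
  · simp [Op.changes]
  · simp [Op.Allowed, size] at hallowed

lemma WorstCase.one_le {L : Alg n m} {W : ℝ} (hW : L.WorstCase W) (hn : 0 < n) : 1 ≤ W := by
  have hx : Legal n [.insert 0] :=
    legal_append_singleton (h := []).2 ⟨legal_nil, le_rfl, hn⟩
  obtain ⟨ω⟩ := nonempty_of_isProbabilityMeasure L.μ
  have h1 := hW _ hx 0 (by simp) ω
  have h2 := (L.run ω).one_le_cost_zero hx (by simp)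
  have h3 : (1 : ℝ) ≤ ((L.run ω).cost [.insert 0] 0 : ℝ) := by exact_mod_cast h2
  exact h3.trans h1

lemma AmortizedFrom.one_le {L : Alg n m} {x : List Op} {c : ℝ} (h : L.AmortizedFrom 0 x c)
    (hx : Legal n x) (h0 : 0 < x.length) : 1 ≤ c := by
  have h1 := h 1 h0 (by simp)
  have h2 := L.le_expCost hx (i := 0) (j := 1) (c := 1) fun ω => by
    simpa using (L.run ω).one_le_cost_zero hx h0
  simp only [Nat.cast_one, one_mul] at h1 h2
  exact h2.trans h1

lemma _root_.ListLabeling.exists_costly_sequence {n : ℕ} (hn : 0 < n) (T : ℕ) :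
    ∃ x, Legal n x ∧ size x = 0 ∧ x.length = 2 * T ∧
      ∀ (m : ℕ) (D : DetAlg n m), T ≤ ∑ t ∈ Ico 0 (2 * T), D.cost x t := by
  induction T with
  | zero => exact ⟨[], legal_nil, rfl, rfl, by simp⟩
  | succ T ih =>
    obtain ⟨x, hx, hs, hlen, H⟩ := ih
    have h1 : Legal n (x ++ [.insert 0]) :=
      legal_append_singleton.2 ⟨hx, Nat.zero_le _, by rwa [hs]⟩
    have hs1 : size (x ++ [.insert 0]) = 1 := by simp [hs, Op.newSize]
    have h2 : Legal n ((x ++ [.insert 0]) ++ [.delete 0]) :=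
      legal_append_singleton.2 ⟨h1, by rw [hs1]; exact Nat.one_pos⟩
    refine ⟨_, h2, by rw [size_append_singleton, hs1]; rfl,
      by simp [hlen]; omega, fun m D => ?_⟩
    have h3 := H m D
    rw [← hlen] at h3
    rw [show 2 * (T + 1) = x.length + 1 + 1 by omega, sum_Ico_succ_top (by omega),
      sum_Ico_succ_top (by omega), D.cost_append _ _ (by simp), D.cost_append_singleton x,
      List.append_assoc, D.sum_cost_of_isPrefix (List.prefix_append _ _)]
    simp only [Op.changes]
    omega

/-- Alternating insertions and deletions cost at least one per pair; on long sequences the additive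
term becomes negligible. The bound serves to absorb constants into the cost parameter. -/
lemma LightlyAmortized.one_le {L : Alg n m} {A c : ℝ} (h : L.LightlyAmortized A c)
    (hn : 0 < n) : 1 ≤ 2 * A * c := by
  by_contra hlt
  rw [not_le] at hlt
  obtain ⟨T, hT⟩ := exists_nat_gt (A * n / (1 - 2 * A * c))
  rw [div_lt_iff₀ (by linarith)] at hT
  obtain ⟨x, hx, -, hlen, H⟩ := exists_costly_sequence hn T
  have h1 := h x hx 0 (2 * T) (Nat.zero_le _) hlen.ge
  have h2 := L.le_expCost hx fun ω => H m (L.run ω)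
  push_cast at h1
  nlinarith

end Cost

end Alg

end ListLabeling

/-! ### The rate, measurability and the expected cost of the combination -/

namespace ListLabeling

open Finset MeasureTheory

/-- The rate of the rebuilding. -/
noncomputable def rate (n e : ℕ) (E W : ℝ) : ℕ :=
  ⌈min E W⌉₊ + if e = 0 then n else 8 * n / e + 1

/-- For `e = 0` the rate is at least `n`, so every transition is direct and the construction is
defined for all `n` and `e`. -/
lemma rate_spec (n e : ℕ) (E W : ℝ) : n ≤ rate n e E W ∨ 8 * n ≤ rate n e E W * e := by
  unfold rate
  split_ifs with he
  · exact Or.inl (Nat.le_add_left _ _)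
  · refine Or.inr (le_trans ?_ (Nat.mul_le_mul_right e (Nat.le_add_left _ _)))
    have := Nat.lt_div_mul_add (a := 8 * n) (Nat.pos_of_ne_zero he)
    rw [add_mul, one_mul]
    omega

lemma le_rate (n e : ℕ) (E W : ℝ) : min E W ≤ rate n e E W := by
  refine (Nat.le_ceil _).trans ?_
  exact_mod_cast Nat.le_add_right _ _

lemma rate_le {n e : ℕ} {E W lo : ℝ} (hlo : 0 < lo) (he : 0 < e) (hle : lo * n ≤ e)
    (hpos : 0 ≤ min E W) : (rate n e E W : ℝ) ≤ min E W + (2 + 8 / lo) := by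
  have h1 := (Nat.ceil_lt_add_one hpos).le
  have h2 : ((8 * n / e : ℕ) : ℝ) ≤ 8 / lo := by
    refine Nat.cast_div_le.trans ?_
    have he' : (0 : ℝ) < e := by exact_mod_cast he
    rw [div_le_div_iff₀ he' hlo]
    push_cast
    linarith
  simp only [rate, if_neg he.ne']
  push_cast
  linarith

variable {n e b : ℕ}

lemma measurable_combineDet {m : ℕ} (hb : n ≤ b ∨ 8 * n ≤ b * e) (F : Alg n (n + e))
    (R : Alg (n + 2 * e) m) (h : List Op) (i : ℕ) :
    Measurable fun ω : F.Ω × R.Ω => (combineDet hb (F.run ω.1) (R.run ω.2)).pos h i := by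
  let u : F.Ω → (Fin (h.length + 1) × Fin n → ℕ) := fun ω j => (F.run ω).pos (h.take j.1) j.2
  have hu : Measurable u := measurable_pi_lambda _ fun j => F.measurable_pos _ _
  have hfac : (fun ω => stateAfter n e b (F.run ω) h).FactorsThrough u := by
    intro ω ω' hω
    refine stateAfter_congr fun t ht => funext fun l => ?_
    unfold DetAlg.posBelow
    split_ifs with hl
    · exact congrFun hω (⟨t, by omega⟩, ⟨l, hl⟩)
    · rfl
  have : Nonempty State := ⟨State.init n e⟩
  obtain ⟨g, hg⟩ := (Function.factorsThrough_iff _).1 hfac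
  have hΨ : Measurable fun z : (Fin (h.length + 1) × Fin n → ℕ) × R.Ω =>
      (g z.1).slots (R.run z.2) i :=
    -- The positions of `F` that matter form a finite tuple of naturals, hence range over a
    -- countable type; only measurability in the bits of `R` remains.
    measurable_from_prod_countable_right fun v =>
      R.measurable_pos (g v).hist (rank (g v).keys ((g v).cur i))
  have := hΨ.comp ((hu.comp measurable_fst).prodMk measurable_snd)
  convert this using 2 with ω
  exact congrArg (fun s : State => s.slots (R.run ω.2) i) (congrFun hg ω.1)

namespace Alg

lemma integrable_affine {Ω : Type*} [MeasurableSpace Ω] {μ : Measure Ω} [IsProbabilityMeasure μ]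
    {f : Ω → ℝ} (hf : Integrable f μ) (a b : ℝ) : Integrable (fun ω => a + b * f ω) μ :=
  (integrable_const a).add (hf.const_mul b)

lemma integral_affine {Ω : Type*} [MeasurableSpace Ω] {μ : Measure Ω} [IsProbabilityMeasure μ]
    {f : Ω → ℝ} (hf : Integrable f μ) (a b : ℝ) :
    ∫ ω, a + b * f ω ∂μ = a + b * ∫ ω, f ω ∂μ := by
  rw [integral_add (integrable_const a) (hf.const_mul b), integral_const_mul]
  simp

lemma expCost_combine_le {n₁ m₁ n₂ m₂ n m : ℕ} {f : DetAlg n₁ m₁ → DetAlg n₂ m₂ → DetAlg n m}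
    {F : Alg n₁ m₁} {R : Alg n₂ m₂}
    (hf : ∀ h i, Measurable fun ω : F.Ω × R.Ω => (f (F.run ω.1) (R.run ω.2)).pos h i)
    {x : List Op} (hx : Legal n x) {i j : ℕ} {B : F.Ω → ℝ} (hB : Integrable B F.μ)
    (H : ∀ ω, ∫ ω', (∑ t ∈ Ico i j, ((f (F.run ω) (R.run ω')).cost x t : ℝ)) ∂(R.μ) ≤ B ω) :
    (combine f F R hf).expCost x i j ≤ ∫ ω, B ω ∂F.μ := by
  have hint : Integrable (fun ω : F.Ω × R.Ω =>
      ∑ t ∈ Ico i j, ((f (F.run ω.1) (R.run ω.2)).cost x t : ℝ)) (F.μ.prod R.μ) :=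
    (combine f F R hf).integrable_sum_cost hx _
  change ∫ ω : F.Ω × R.Ω, (∑ t ∈ Ico i j, ((f (F.run ω.1) (R.run ω.2)).cost x t : ℝ))
    ∂(F.μ.prod R.μ) ≤ _
  rw [integral_prod _ hint]
  exact integral_mono hint.integral_prod_left hB H

variable {F : Alg n (n + e)} {R : Alg (n + 2 * e) (n + 3 * e)} {A E W : ℝ}

/-- The expected cost of the combination on a part of an input sequence, for fixed random bits of
the fast algorithm. -/
lemma _root_.ListLabeling.WindowCost.integral_le {hb : n ≤ b ∨ 8 * n ≤ b * e} (hA : 0 < A)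
    (hE : 0 ≤ E) (hW : 0 ≤ W) (hRE : R.LightlyAmortized A E) (hRW : R.WorstCase W)
    {D : DetAlg n (n + e)} {x : List Op} (hx : Legal n x) {i j c : ℕ}
    (H : WindowCost hb D x i j c) :
    ∃ l : ℝ, 0 ≤ l ∧ l ≤ 4 * ((j - i : ℕ) : ℝ) ∧ l * (b + 1) ≤ 4 * c ∧
      ∫ ω, (∑ t ∈ Ico i j, ((combineDet hb D (R.run ω)).cost x t : ℝ)) ∂(R.μ) ≤
        c + (A + 1) * (l * min E W) + A * (n + 2 * e) := by
  have hv := (stateAfter_valid hb D (hx.take j)).legal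
  have hle := H.isPrefix.length_le
  have hlen := H.length_le
  have hmul := H.length_mul_le
  have hsum := H.sum_le
  set h := (stateAfter n e b D (x.take i)).hist
  set h' := (stateAfter n e b D (x.take j)).hist
  have hcast : ((h'.length - h.length : ℕ) : ℝ) = (h'.length : ℝ) - h.length := Nat.cast_sub hle
  have hl0 : (0 : ℝ) ≤ (h'.length : ℝ) - h.length := by rw [← hcast]; positivity
  refine ⟨(h'.length : ℝ) - h.length, hl0, ?_, ?_, ?_⟩
  · rw [← hcast]
    exact_mod_cast (by omega : h'.length - h.length ≤ 4 * (j - i))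
  · rw [← hcast]
    exact_mod_cast hmul
  · have hRint := R.integrable_sum_cost hv (Ico h.length h'.length)
    have h1 : ∫ ω, (∑ t ∈ Ico i j, ((combineDet hb D (R.run ω)).cost x t : ℝ)) ∂(R.μ) ≤
        c + R.expCost h' h.length h'.length := by
      refine (integral_mono_of_nonneg ?_ (integrable_affine hRint c 1) ?_).trans_eq ?_
      · exact Filter.Eventually.of_forall fun ω => by positivity
      · exact Filter.Eventually.of_forall fun ω => by
          dsimp only
          rw [one_mul]
          exact_mod_cast hsum _ (R.run ω)
      · rw [integral_affine hRint, one_mul]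
        rfl
    have h2 := hRE h' hv h.length h'.length hle le_rfl
    have h3 := hRW.expCost_le hv hle le_rfl
    push_cast at h2
    have hN : (0 : ℝ) ≤ A * (n + 2 * e) := by positivity
    -- Light amortization gives the bound if the minimum is `E`, the worst-case cost if it is `W`.
    rcases min_cases E W with ⟨hm, -⟩ | ⟨hm, -⟩ <;> rw [hm]
    · have := mul_nonneg hl0 hE
      linarith
    · have := mul_nonneg hA.le (mul_nonneg hl0 hW)
      linarith

lemma expCost_combineDet_le_work {hb : n ≤ b ∨ 8 * n ≤ b * e} (hA : 0 < A) (hE : 0 ≤ E)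
    (hW : 0 ≤ W) (hRE : R.LightlyAmortized A E) (hRW : R.WorstCase W)
    (hm : ∀ h i, Measurable fun ω : F.Ω × R.Ω =>
      (combineDet hb (F.run ω.1) (R.run ω.2)).pos h i)
    {x : List Op} (hx : Legal n x) {i j : ℕ} (hij : i ≤ j) (hj : j ≤ x.length) :
    (combine (combineDet hb) F R hm).expCost x i j ≤
      ((j : ℝ) - i) * (b + 2 + 4 * (A + 1) * E) + A * (n + 2 * e) := by
  refine (expCost_combine_le hm hx (integrable_const
    (((j : ℝ) - i) * (b + 2 + 4 * (A + 1) * E) + A * (n + 2 * e))) fun ω => ?_).trans_eq (by simp)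
  obtain ⟨c, H⟩ := exists_windowCost hb (F.run ω) hx hij hj
  obtain ⟨l, hl0, hl, -, hint⟩ := H.integral_le hA hE hW hRE hRW hx
  refine hint.trans ?_
  have hc : (c : ℝ) ≤ ((j : ℝ) - i) * (b + 2) := by
    rw [← Nat.cast_sub hij]
    exact_mod_cast H.cost_le
  rw [Nat.cast_sub hij] at hl
  have h1 : l * min E W ≤ 4 * ((j : ℝ) - i) * E :=
    mul_le_mul hl (min_le_left _ _) (le_min hE hW) (hl0.trans hl)
  have h2 := mul_le_mul_of_nonneg_left h1 (by linarith : (0 : ℝ) ≤ A + 1)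
  linarith

/-- Since `min E W ≤ b`, the inequality `l * (b + 1) ≤ 4 * c` charges the calls of `R` to `c`, and
the potential charges `c` to `F`. -/
lemma expCost_combineDet_le_fast {hb : n ≤ b ∨ 8 * n ≤ b * e} (hA : 0 < A) (hE : 0 ≤ E)
    (hW : 0 ≤ W) (hRE : R.LightlyAmortized A E) (hRW : R.WorstCase W) (hbE : min E W ≤ b)
    (hm : ∀ h i, Measurable fun ω : F.Ω × R.Ω =>
      (combineDet hb (F.run ω.1) (R.run ω.2)).pos h i)
    {x : List Op} (hx : Legal n x) {i j : ℕ} (hij : i ≤ j) (hj : j ≤ x.length) :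
    (combine (combineDet hb) F R hm).expCost x i j ≤
      (1 + 4 * (A + 1)) * (5 * n + 6 * F.expCost x i j) + A * (n + 2 * e) := by
  have hFint := F.integrable_sum_cost hx (Ico i j)
  refine (expCost_combine_le hm hx (integrable_affine hFint
    ((1 + 4 * (A + 1)) * (5 * n) + A * (n + 2 * e)) ((1 + 4 * (A + 1)) * 6))
    fun ω => ?_).trans_eq ?_
  · obtain ⟨c, H⟩ := exists_windowCost hb (F.run ω) hx hij hj
    obtain ⟨l, hl0, -, hl, hint⟩ := H.integral_le hA hE hW hRE hRW hx
    refine hint.trans ?_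
    have hc : (c : ℝ) ≤ 5 * n + 6 * ∑ t ∈ Ico i j, ((F.run ω).cost x t : ℝ) := by
      exact_mod_cast H.cost_le_of_potential hx
    have h1 : l * min E W ≤ 4 * c :=
      (mul_le_mul_of_nonneg_left (hbE.trans (by linarith)) hl0).trans hl
    have h2 := mul_le_mul_of_nonneg_left h1 (by linarith : (0 : ℝ) ≤ A + 1)
    have h3 := mul_le_mul_of_nonneg_left hc (by linarith : (0 : ℝ) ≤ 1 + 4 * (A + 1))
    linarith
  · rw [integral_affine hFint, expCost]
    ring

lemma worstCase_combineDet {hb : n ≤ b ∨ 8 * n ≤ b * e} (hW : 0 ≤ W) (hRW : R.WorstCase W)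
    (hm : ∀ h i, Measurable fun ω : F.Ω × R.Ω =>
      (combineDet hb (F.run ω.1) (R.run ω.2)).pos h i) :
    (combine (combineDet hb) F R hm).WorstCase (b + 2 + 4 * W) := by
  rintro x hx t ht ⟨ω, ω'⟩
  change ((combineDet hb (F.run ω) (R.run ω')).cost x t : ℝ) ≤ _
  obtain ⟨c, H⟩ := exists_windowCost hb (F.run ω) hx (Nat.le_succ t) ht
  have hv := (stateAfter_valid hb (F.run ω) (hx.take (t + 1))).legal
  have h1 := H.sum_le _ (R.run ω')
  have h2 := H.cost_le
  have h3 := H.length_le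
  simp only [Nat.succ_eq_add_one, Nat.Ico_succ_singleton, sum_singleton,
    Nat.add_sub_cancel_left, one_mul, mul_one] at h1 h2 h3
  set h := (stateAfter n e b (F.run ω) (x.take t)).hist
  set h' := (stateAfter n e b (F.run ω) (x.take (t + 1))).hist
  have h4 : ∑ s ∈ Ico h.length h'.length, ((R.run ω').cost h' s : ℝ) ≤ 4 * W := by
    calc _ ≤ ∑ s ∈ Ico h.length h'.length, W :=
          sum_le_sum fun s hs => hRW h' hv s (mem_Ico.1 hs).2 ω'
      _ = ((h'.length - h.length : ℕ) : ℝ) * W := by simp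
      _ ≤ 4 * W := by
          refine mul_le_mul_of_nonneg_right ?_ hW
          exact_mod_cast (by omega : h'.length - h.length ≤ 4)
  have h5 : ((combineDet hb (F.run ω) (R.run ω')).cost x t : ℝ) ≤
      c + ∑ s ∈ Ico h.length h'.length, ((R.run ω').cost h' s : ℝ) := by exact_mod_cast h1
  have h6 : (c : ℝ) ≤ b + 2 := by exact_mod_cast h2
  linarith

end Alg

end ListLabeling

open ListLabeling
theorem theorem1 (lo hi A : ℝ) (hlo : 0 < lo) (hA : 0 < A) :
    ∃ C : ℝ, 0 < C ∧
      ∃ embed : (n e : ℕ) → (E W : ℝ) →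
          DetAlg n (n + e) → DetAlg (n + 2 * e) (n + 3 * e) → DetAlg n (n + 3 * e),
        ∀ n e : ℕ, lo * n ≤ e → (e : ℝ) ≤ hi * n →
        ∀ (R : Alg (n + 2 * e) (n + 3 * e)) (E W : ℝ),
          R.LightlyAmortized A E → R.WorstCase W →
        ∀ F : Alg n (n + e),
          ∃ hm : ∀ h i, Measurable fun ω : F.Ω × R.Ω =>
              (embed n e E W (F.run ω.1) (R.run ω.2)).pos h i,
            (Alg.combine (embed n e E W) F R hm).WorstCase (C * W) ∧
            (∀ G : List Op → ℝ, (∀ x, Legal n x → F.AmortizedFrom 0 x (G x)) →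
              ∀ x, Legal n x →
                (∀ t ≤ x.length,
                  (Alg.combine (embed n e E W) F R hm).expCost x 0 t ≤ C * (t * G x + n)) ∧
                (∀ δ : ℝ, 0 < δ →
                  (Alg.combine (embed n e E W) F R hm).AmortizedFrom (δ * n) x
                    (C * (1 + 1 / δ) * G x))) ∧
            (Alg.combine (embed n e E W) F R hm).LightlyAmortized C E ∧
            (∀ g : ℝ, F.LightlyAmortized A g →
              (Alg.combine (embed n e E W) F R hm).LightlyAmortized C g) := by
  -- `K` is chosen so that `rate + 2 ≤ min E W + K`, `D` is the factor in front of `c` in the fast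
  -- bound, and `H * n` bounds `A * (n + 2 * e)`.
  obtain ⟨K, hK⟩ : ∃ K, K = 4 + 8 / lo := ⟨_, rfl⟩
  obtain ⟨D, hD⟩ : ∃ D, D = 1 + 4 * (A + 1) := ⟨_, rfl⟩
  obtain ⟨H, hH⟩ : ∃ H, H = A * (1 + 2 * |hi|) := ⟨_, rfl⟩
  have hK0 : 0 < K := by rw [hK]; positivity
  have hD0 : 0 < D := by rw [hD]; positivity
  have hH0 : 0 < H := by rw [hH]; positivity
  have hAK : 0 < A * K := by positivity
  have hDA : 0 < D * A := by positivity
  obtain ⟨C, hC⟩ : ∃ C, C = 5 + K + 6 * D + 6 * (D * A) + H + 2 * (A * K) := ⟨_, rfl⟩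
  have hC0 : 0 < C := by rw [hC]; positivity
  refine ⟨C, hC0, fun n e E W => combineDet (rate_spec n e E W), ?_⟩
  intro n e hle hhi R E W hRE hRW F
  have hm := measurable_combineDet (rate_spec n e E W) F R
  refine ⟨hm, ?_⟩
  have hzero : ∀ x, (Alg.combine (combineDet (rate_spec n e E W)) F R hm).expCost x 0 0 = 0 := by
    intro x
    simp [Alg.expCost]
  rcases Nat.eq_zero_or_pos n with rfl | hn
  · refine ⟨fun x hx t ht => ?_, fun G _ x hx => ⟨fun t ht => ?_, fun δ _ t ht _ => ?_⟩,
      fun x hx a b hab hb => ?_, fun g _ x hx a b hab hb => ?_⟩ <;> obtain rfl := legal_zero hx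
    · simp at ht
    · obtain rfl : t = 0 := by simpa using ht
      simp [hzero]
    · obtain rfl : t = 0 := by simpa using ht
      simp [hzero]
    · obtain rfl : b = 0 := by simpa using hb
      obtain rfl : a = 0 := by omega
      simp [hzero]
    · obtain rfl : b = 0 := by simpa using hb
      obtain rfl : a = 0 := by omega
      simp [hzero]
  have hn' : (0 : ℝ) < n := by exact_mod_cast hn
  have he : 0 < e := by
    have : (0 : ℝ) < e := lt_of_lt_of_le (by positivity) hle
    exact_mod_cast this
  -- These lower bounds turn the additive constant `K` into a multiple of `W` or of `E`.
  have hW1 : 1 ≤ W := hRW.one_le (by omega)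
  have hE1 : 1 ≤ 2 * A * E := hRE.one_le (by omega)
  have hE0 : 0 < E := by
    by_contra h
    have := mul_nonneg hA.le (neg_nonneg.2 (not_lt.1 h))
    linarith
  have hW0 : 0 ≤ W := by linarith
  have hrate := rate_le hlo he hle (le_min hE0.le hW0)
  have hHn : A * (n + 2 * e) ≤ H * n := by
    have h1 : hi * n ≤ |hi| * n := mul_le_mul_of_nonneg_right (le_abs_self hi) hn'.le
    have h2 := mul_le_mul_of_nonneg_left (by linarith : (n : ℝ) + 2 * e ≤ n + 2 * (|hi| * n))
      hA.le
    rw [hH]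
    linarith
  have hwork := fun x hx i j hij hj => Alg.expCost_combineDet_le_work (F := F)
    hA hE0.le hW0 hRE hRW hm
    (x := x) hx (i := i) (j := j) hij hj
  have hfast := fun x hx i j hij hj => Alg.expCost_combineDet_le_fast (F := F)
    hA hE0.le hW0 hRE hRW
    (le_rate n e E W) hm (x := x) hx (i := i) (j := j) hij hj
  rw [← hD] at hfast
  have hgood : ∀ {x}, Legal n x → ∀ {i j}, i ≤ j → j ≤ x.length → ∀ {B : ℝ}, 0 ≤ B →
      F.expCost x i j ≤ B → (Alg.combine (combineDet (rate_spec n e E W)) F R hm).expCost x i j ≤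
        6 * D * B + (5 * D + H) * n := by
    intro x hx i j hij hj B hB hFB
    have h1 := hfast x hx i j hij hj
    have h2 := mul_le_mul_of_nonneg_left hFB hD0.le
    linarith
  refine ⟨fun x hx t ht ω => ?_, fun G hG x hx => ?_, fun x hx a b hab hb => ?_,
    fun g hg x hx a b hab hb => ?_⟩
  · refine (Alg.worstCase_combineDet hW0 hRW hm x hx t ht ω).trans ?_
    have h1 := min_le_right E W
    have h2 : K ≤ K * W := le_mul_of_one_le_right hK0.le hW1
    have h3 : (5 + K) * W ≤ C * W := mul_le_mul_of_nonneg_right (by rw [hC]; linarith) hW0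
    linarith
  · have hmain : ∀ t ≤ x.length, (Alg.combine (combineDet (rate_spec n e E W)) F R hm).expCost x 0 t
        ≤ C * (t * G x + n) ∧ (0 < t → 1 ≤ G x) := by
      intro t ht
      rcases Nat.eq_zero_or_pos t with rfl | h0
      · exact ⟨by rw [hzero]; simp; positivity, by simp⟩
      · have hG1 : 1 ≤ G x := (hG x hx).one_le hx (by omega)
        have hB : 0 ≤ t * G x := by positivity
        refine ⟨(hgood hx (Nat.zero_le t) ht hB (hG x hx t ht (by positivity))).trans ?_,
          fun _ => hG1⟩
        have h1 : 6 * D * (t * G x) ≤ C * (t * G x) :=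
          mul_le_mul_of_nonneg_right (by rw [hC]; linarith) hB
        have h2 : (5 * D + H) * n ≤ C * n :=
          mul_le_mul_of_nonneg_right (by rw [hC]; linarith) hn'.le
        linarith
    refine ⟨fun t ht => (hmain t ht).1, fun δ hδ t ht hδt => ?_⟩
    obtain ⟨h1, h2⟩ := hmain t ht
    rcases Nat.eq_zero_or_pos t with rfl | h0
    · simp [hzero]
    · refine h1.trans ?_
      have h3 : (n : ℝ) ≤ t / δ := by rw [le_div_iff₀ hδ]; linarith
      have h4 : (t : ℝ) / δ ≤ t / δ * G x := le_mul_of_one_le_right (by positivity) (h2 h0)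
      calc C * (t * G x + n) ≤ C * (t * G x + t / δ * G x) := by gcongr; exact h3.trans h4
        _ = t * (C * (1 + 1 / δ) * G x) := by ring
  · refine (hwork x hx a b hab hb).trans ?_
    have hT : (0 : ℝ) ≤ (b : ℝ) - a := sub_nonneg.2 (by exact_mod_cast hab)
    have h1 := min_le_left E W
    have h2 := mul_le_mul_of_nonneg_left hE1 hK0.le
    have h3 : (rate n e E W : ℝ) + 2 + 4 * (A + 1) * E ≤ (D + 2 * (A * K)) * E := by
      rw [hD]
      linarith
    have h4 : (D + 2 * (A * K)) * E ≤ C * E :=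
      mul_le_mul_of_nonneg_right (by rw [hC]; linarith) hE0.le
    have h5 := mul_le_mul_of_nonneg_left (h3.trans h4) hT
    have h6 : H * n ≤ C * n := mul_le_mul_of_nonneg_right (by rw [hC]; linarith) hn'.le
    linarith
  · have hT : (0 : ℝ) ≤ (b : ℝ) - a := sub_nonneg.2 (by exact_mod_cast hab)
    have hg1 : 1 ≤ 2 * A * g := hg.one_le hn
    have hg0 : 0 ≤ g := by
      by_contra h
      have := mul_nonneg hA.le (neg_nonneg.2 (not_le.1 h).le)
      linarith
    have hTg := mul_nonneg hT hg0
    refine (hgood hx hab hb (by positivity) (hg x hx a b hab hb)).trans ?_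
    have h1 : 6 * (D * A) * (((b : ℝ) - a) * g) ≤ C * (((b : ℝ) - a) * g) :=
      mul_le_mul_of_nonneg_right (by rw [hC]; linarith) hTg
    have h2 : (6 * (D * A) + 5 * D + H) * n ≤ C * n :=
      mul_le_mul_of_nonneg_right (by rw [hC]; linarith) hn'.le
    linarith
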